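/- Let $A$ and $B$ be associative rings with unit, let $(\mathcal C,\Delta,\varepsilon)$ be an $A$-coring and $\mathcal D$ a $B$-coring, and let $N$ be a $(\mathcal C,\mathcal D)$-bicomodule, with left coaction ${}^N\!\varrho:N\to\mathcal C\otimes_A N$ and right coaction $\varrho^N:N\to N\otimes_B\mathcal D$. Let $\mathbb M_A$, $\mathbb M_B$ be the categories of right modules, $\mathbb M^{\mathcal D}$ the category of right $\mathcal D$-comodules (comodules of the comonad $-\otimes_B\mathcal D$ on $\mathbb M_B$), and $\mathbb M_{[\mathcal C,-]}$ the category of right $\mathcal C$-contramodules, that is, modules of the monad $[\mathcal C,-]=\mathrm{Hom}_A(\mathcal C,-)$ on $\mathbb M_A$. For $Q\in\mathbb M^{\mathcal D}$, the set $\mathrm{Hom}^{\mathcal D}(N,Q)$ of comodule maps is a right $A$-module by $(fa)(n)=f(an)$, and a contramodule by the action sending $h\in\mathrm{Hom}_A(\mathcal C,\mathrm{Hom}^{\mathcal D}(N,Q))$ to the composite of ${}^N\!\varrho$ with $c\otimes n\mapsto h(c)(n)$; in the same way $\mathrm{Hom}_B(N,X)$ is a contramodule for $X\in\mathbb M_B$.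 For a contramodule $(M,\alpha_M)$, the contratensor product $M\otimes_{[\mathcal C,-]}N$ is the coequaliser of the two maps $\mathrm{Hom}_A(\mathcal C,M)\otimes_A N\to M\otimes_A N$ given by $f\otimes n\mapsto (f\otimes_A N)({}^N\!\varrho(n))$ and by $\alpha_M\otimes_A N$. The bicomodule $N$ is called $[\mathcal C,-]$-Galois if for every $X\in\mathbb M_A$ the map $\mathrm{Hom}_A(\mathcal C,X)\to\mathrm{Hom}^{\mathcal D}(N,X\otimes_A N)$, $f\mapsto (f\otimes_A N)\circ{}^N\!\varrho$, is an isomorphism, where $X\otimes_A N$ has the coaction $X\otimes_A\varrho^N$. It is called $\mathcal D$-Galois if for every $X\in\mathbb M_B$ the map $\mathrm{Hom}_B(N,X)\otimes_{[\mathcal C,-]}N\to X\otimes_B\mathcal D$, induced by $f\otimes n\mapsto (f\otimes_B\mathcal D)(\varrho^N(n))$, is an isomorphism. Then the following are equivalent: (a) the functor $\mathrm{Hom}^{\mathcal D}(N,-):\mathbb M^{\mathcal D}\to\mathbb M_{[\mathcal C,-]}$ is an equivalence, $\mathcal C$ is a projective right $A$-module and $\mathcal D$ is a flat left $B$-module;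 (b) $\mathcal D$ is flat as a left $B$-module, and $N$ is a $[\mathcal C,-]$-Galois bicomodule and a projective generator in $\mathbb M^{\mathcal D}$; (c) $\mathcal C$ is projective as a right $A$-module, $N$ is a $\mathcal D$-Galois bicomodule, and the functor $-\otimes_{[\mathcal C,-]}N:\mathbb M_{[\mathcal C,-]}\to\mathbb M_B$ is left exact and faithful. -/

import Mathlib

open CategoryTheory CategoryTheory.Limits MulOpposite

universe u

noncomputable section

/-! ## Tensor products over a noncommutative ring

Right `R`-modules are modules over `Rᵐᵒᵖ`, and an `(R, S)`-bimodule is a module over `R` and over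
`Sᵐᵒᵖ` whose actions commute. -/

/-- The tensor product `M ⊗_R N` of a right `R`-module `M` and a left `R`-module `N`, over an
arbitrary ring `R`: the quotient of `M ⊗_ℤ N` by the elements `m r ⊗ n - m ⊗ r n`. -/
def TensorOver (R : Type*) [Ring R] (M : Type*) [AddCommGroup M] [Module Rᵐᵒᵖ M]
    (N : Type*) [AddCommGroup N] [Module R N] : Type _ :=
  TensorProduct ℤ M N ⧸ AddSubgroup.closure
    {t : TensorProduct ℤ M N | ∃ (m : M) (r : R) (n : N),
      t = TensorProduct.tmul ℤ (op r • m) n - TensorProduct.tmul ℤ m (r • n)}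

namespace TensorOver

section Basic

variable {R : Type*} [Ring R] {M : Type*} [AddCommGroup M] [Module Rᵐᵒᵖ M]
  {N : Type*} [AddCommGroup N] [Module R N]

instance : AddCommGroup (TensorOver R M N) :=
  inferInstanceAs (AddCommGroup (TensorProduct ℤ M N ⧸ AddSubgroup.closure
    {t : TensorProduct ℤ M N | ∃ (m : M) (r : R) (n : N),
      t = TensorProduct.tmul ℤ (op r • m) n - TensorProduct.tmul ℤ m (r • n)}))

variable (R) in
/-- The element `m ⊗ n` of `M ⊗_R N`. -/
def tmul (m : M) (n : N) : TensorOver R M N :=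
  QuotientAddGroup.mk (TensorProduct.tmul ℤ m n)

theorem add_tmul (m m' : M) (n : N) : tmul R (m + m') n = tmul R m n + tmul R m' n :=
  congrArg QuotientAddGroup.mk (TensorProduct.add_tmul m m' n)

theorem tmul_add (m : M) (n n' : N) : tmul R m (n + n') = tmul R m n + tmul R m n' :=
  congrArg QuotientAddGroup.mk (TensorProduct.tmul_add m n n')

theorem zero_tmul (n : N) : tmul R (0 : M) n = 0 :=
  congrArg QuotientAddGroup.mk (TensorProduct.zero_tmul M n)

theorem tmul_zero (m : M) : tmul R m (0 : N) = 0 :=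
  congrArg QuotientAddGroup.mk (TensorProduct.tmul_zero N m)

theorem smul_tmul (m : M) (r : R) (n : N) : tmul R (op r • m) n = tmul R m (r • n) := by
  refine QuotientAddGroup.eq.2 ?_
  have h : TensorProduct.tmul ℤ (op r • m) n - TensorProduct.tmul ℤ m (r • n) ∈
      AddSubgroup.closure {t : TensorProduct ℤ M N | ∃ (m : M) (r : R) (n : N),
        t = TensorProduct.tmul ℤ (op r • m) n - TensorProduct.tmul ℤ m (r • n)} :=
    AddSubgroup.subset_closure ⟨m, r, n, rfl⟩
  have h' := neg_mem h
  rwa [neg_sub, sub_eq_neg_add] at h'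

@[elab_as_elim]
theorem induction_on {p : TensorOver R M N → Prop} (t : TensorOver R M N) (h0 : p 0)
    (ht : ∀ m n, p (tmul R m n)) (ha : ∀ x y, p x → p y → p (x + y)) : p t := by
  obtain ⟨s, rfl⟩ := QuotientAddGroup.mk_surjective t
  induction s using TensorProduct.induction_on with
  | zero => exact h0
  | tmul m n => exact ht m n
  | add x y hx hy => exact ha _ _ hx hy

/-- The universal property of `M ⊗_R N`: a biadditive `R`-balanced map induces an additive map. -/
def lift {P : Type*} [AddCommGroup P] (f : M →+ N →+ P)
    (hf : ∀ (m : M) (r : R) (n : N), f (op r • m) n = f m (r • n)) : TensorOver R M N →+ P :=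
  QuotientAddGroup.lift _
    (TensorProduct.liftAddHom f (fun z m n => by
      rw [map_zsmul, map_zsmul, AddMonoidHom.zsmul_apply]))
    (by
      rw [AddSubgroup.closure_le]
      rintro _ ⟨m, r, n, rfl⟩
      simp [hf])

@[simp]
theorem lift_tmul {P : Type*} [AddCommGroup P] (f : M →+ N →+ P)
    (hf : ∀ (m : M) (r : R) (n : N), f (op r • m) n = f m (r • n)) (m : M) (n : N) :
    lift f hf (tmul R m n) = f m n := rfl

theorem hom_ext {P : Type*} [AddCommGroup P] {f g : TensorOver R M N →+ P}
    (h : ∀ m n, f (tmul R m n) = g (tmul R m n)) : f = g := by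
  ext t
  induction t using induction_on with
  | h0 => simp
  | ht m n => exact h m n
  | ha x y hx hy => simp [hx, hy]

/-- The map `f ⊗ g : M ⊗_R N → M' ⊗_R N'`. -/
def map {M' : Type*} [AddCommGroup M'] [Module Rᵐᵒᵖ M'] {N' : Type*} [AddCommGroup N']
    [Module R N'] (f : M →ₗ[Rᵐᵒᵖ] M') (g : N →ₗ[R] N') :
    TensorOver R M N →+ TensorOver R M' N' :=
  lift
    (AddMonoidHom.mk' (fun m => AddMonoidHom.mk' (fun n => tmul R (f m) (g n))
        (fun n n' => by rw [map_add, tmul_add]))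
      (fun m m' => by ext n; simp [add_tmul]))
    (fun m r n => by simp [smul_tmul])

@[simp]
theorem map_tmul {M' : Type*} [AddCommGroup M'] [Module Rᵐᵒᵖ M'] {N' : Type*} [AddCommGroup N']
    [Module R N'] (f : M →ₗ[Rᵐᵒᵖ] M') (g : N →ₗ[R] N') (m : M) (n : N) :
    map f g (tmul R m n) = tmul R (f m) (g n) := rfl

theorem map_id : map (R := R) (LinearMap.id : M →ₗ[Rᵐᵒᵖ] M) (LinearMap.id : N →ₗ[R] N) =
    AddMonoidHom.id _ := hom_ext (fun _ _ => rfl)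

/-- The left `S`-module structure `s (m ⊗ n) = s m ⊗ n` on `M ⊗_R N`, for an `(S, R)`-bimodule
`M`. -/
instance leftModule {S : Type*} [Ring S] [Module S M] [SMulCommClass S Rᵐᵒᵖ M] :
    Module S (TensorOver R M N) where
  smul s t := map (DistribSMul.toLinearMap Rᵐᵒᵖ M s) LinearMap.id t
  one_smul t := by
    change map (DistribSMul.toLinearMap Rᵐᵒᵖ M (1 : S)) LinearMap.id t = t
    induction t using induction_on with
    | h0 => simp
    | ht m n => simp
    | ha x y hx hy => rw [map_add, hx, hy]
  mul_smul s s' t := by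
    change map (DistribSMul.toLinearMap Rᵐᵒᵖ M (s * s')) LinearMap.id t =
      map (DistribSMul.toLinearMap Rᵐᵒᵖ M s) LinearMap.id
        (map (DistribSMul.toLinearMap Rᵐᵒᵖ M s') LinearMap.id t)
    induction t using induction_on with
    | h0 => simp
    | ht m n => simp [mul_smul]
    | ha x y hx hy => rw [map_add, hx, hy, map_add, map_add]
  smul_zero s := map_zero _
  smul_add s := map_add _
  add_smul s s' t := by
    change map (DistribSMul.toLinearMap Rᵐᵒᵖ M (s + s')) LinearMap.id t =
      map (DistribSMul.toLinearMap Rᵐᵒᵖ M s) LinearMap.id t +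
        map (DistribSMul.toLinearMap Rᵐᵒᵖ M s') LinearMap.id t
    induction t using induction_on with
    | h0 => simp
    | ht m n => simp [add_smul, add_tmul]
    | ha x y hx hy => rw [map_add, hx, hy, map_add, map_add]; abel
  zero_smul t := by
    change map (DistribSMul.toLinearMap Rᵐᵒᵖ M (0 : S)) LinearMap.id t = 0
    induction t using induction_on with
    | h0 => simp
    | ht m n => simp [zero_tmul]
    | ha x y hx hy => rw [map_add, hx, hy, add_zero]

@[simp]
theorem left_smul_tmul {S : Type*} [Ring S] [Module S M] [SMulCommClass S Rᵐᵒᵖ M]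
    (s : S) (m : M) (n : N) : s • tmul R m n = tmul R (s • m) n := rfl

/-- The right `T`-module structure `(m ⊗ n) t = m ⊗ n t` on `M ⊗_R N`, for an `(R, T)`-bimodule
`N`. -/
instance rightModule {T : Type*} [Ring T] [Module Tᵐᵒᵖ N] [SMulCommClass R Tᵐᵒᵖ N] :
    Module Tᵐᵒᵖ (TensorOver R M N) :=
  haveI : SMulCommClass Tᵐᵒᵖ R N := SMulCommClass.symm _ _ _
  { smul := fun s t => map LinearMap.id (DistribSMul.toLinearMap R N s) t
    one_smul := fun t => by
      change map LinearMap.id (DistribSMul.toLinearMap R N (1 : Tᵐᵒᵖ)) t = t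
      induction t using induction_on with
      | h0 => simp
      | ht m n => simp
      | ha x y hx hy => rw [map_add, hx, hy]
    mul_smul := fun s s' t => by
      change map LinearMap.id (DistribSMul.toLinearMap R N (s * s')) t =
        map LinearMap.id (DistribSMul.toLinearMap R N s)
          (map LinearMap.id (DistribSMul.toLinearMap R N s') t)
      induction t using induction_on with
      | h0 => simp
      | ht m n => simp [mul_smul]
      | ha x y hx hy => rw [map_add, hx, hy, map_add, map_add]
    smul_zero := fun s => map_zero _
    smul_add := fun s => map_add _
    add_smul := fun s s' t => by
      change map LinearMap.id (DistribSMul.toLinearMap R N (s + s')) t =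
        map LinearMap.id (DistribSMul.toLinearMap R N s) t +
          map LinearMap.id (DistribSMul.toLinearMap R N s') t
      induction t using induction_on with
      | h0 => simp
      | ht m n => simp [add_smul, tmul_add]
      | ha x y hx hy => rw [map_add, hx, hy, map_add, map_add]; abel
    zero_smul := fun t => by
      change map LinearMap.id (DistribSMul.toLinearMap R N (0 : Tᵐᵒᵖ)) t = 0
      induction t using induction_on with
      | h0 => simp
      | ht m n => simp [tmul_zero]
      | ha x y hx hy => rw [map_add, hx, hy, add_zero] }

@[simp]
theorem right_smul_tmul {T : Type*} [Ring T] [Module Tᵐᵒᵖ N] [SMulCommClass R Tᵐᵒᵖ N]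
    (t : Tᵐᵒᵖ) (m : M) (n : N) : t • tmul R m n = tmul R m (t • n) := rfl

instance {S : Type*} [Ring S] [Module S M] [SMulCommClass S Rᵐᵒᵖ M]
    {T : Type*} [Ring T] [Module Tᵐᵒᵖ N] [SMulCommClass R Tᵐᵒᵖ N] :
    SMulCommClass S Tᵐᵒᵖ (TensorOver R M N) where
  smul_comm s t x := by
    induction x using induction_on with
    | h0 => simp
    | ht m n => simp
    | ha x y hx hy => simp only [smul_add, hx, hy]

/-- The map `f ⊗ N : M ⊗_R N → M' ⊗_R N`, as a map of right `T`-modules for an `(R, T)`-bimodule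
`N`. -/
def rmap {M' : Type*} [AddCommGroup M'] [Module Rᵐᵒᵖ M'] (T : Type*) [Ring T] (N : Type*)
    [AddCommGroup N] [Module R N] [Module Tᵐᵒᵖ N] [SMulCommClass R Tᵐᵒᵖ N] (f : M →ₗ[Rᵐᵒᵖ] M') :
    TensorOver R M N →ₗ[Tᵐᵒᵖ] TensorOver R M' N :=
  { map f LinearMap.id with
    map_smul' := fun t x => by
      change map f LinearMap.id (t • x) = t • map f LinearMap.id x
      induction x using induction_on with
      | h0 => simp
      | ht m n => simp
      | ha x y hx hy => simp only [smul_add, map_add, hx, hy] }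

@[simp]
theorem rmap_tmul {M' : Type*} [AddCommGroup M'] [Module Rᵐᵒᵖ M'] {T : Type*} [Ring T]
    [Module Tᵐᵒᵖ N] [SMulCommClass R Tᵐᵒᵖ N] (f : M →ₗ[Rᵐᵒᵖ] M') (m : M) (n : N) :
    rmap T N f (tmul R m n) = tmul R (f m) n := rfl

variable (R M) in
/-- The canonical map `M ⊗_R R → M`. -/
def rid : TensorOver R M R →+ M :=
  lift
    (AddMonoidHom.mk' (fun m => AddMonoidHom.mk' (fun r => op r • m)
        (fun r r' => by rw [MulOpposite.op_add, add_smul]))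
      (fun m m' => by ext r; simp))
    (fun m r r' => by simp [mul_smul])

@[simp]
theorem rid_tmul (m : M) (r : R) : rid R M (tmul R m r) = op r • m := rfl

variable (R N) in
/-- The canonical map `R ⊗_R N → N`. -/
def lid : TensorOver R R N →+ N :=
  lift
    (AddMonoidHom.mk' (fun r => AddMonoidHom.mk' (fun n => r • n) (fun n n' => smul_add r n n'))
      (fun r r' => by ext n; simp [add_smul]))
    (fun r r' n => by simp [mul_smul])

@[simp]
theorem lid_tmul (r : R) (n : N) : lid R N (tmul R r n) = r • n := rfl

end Basic

section Assoc

variable (R S : Type*) [Ring R] [Ring S] (M : Type*) [AddCommGroup M] [Module Rᵐᵒᵖ M]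
  (N : Type*) [AddCommGroup N] [Module R N] [Module Sᵐᵒᵖ N] [SMulCommClass R Sᵐᵒᵖ N]
  (P : Type*) [AddCommGroup P] [Module S P]

/-- The triadditive map `(m, n, p) ↦ m ⊗ (n ⊗ p)`. -/
def assocAux₁ (m : M) : N →+ P →+ TensorOver R M (TensorOver S N P) :=
  AddMonoidHom.mk' (fun n => AddMonoidHom.mk' (fun p => tmul R m (tmul S n p))
      (fun p p' => by rw [tmul_add, tmul_add]))
    (fun n n' => AddMonoidHom.ext fun p => by
      change tmul R m (tmul S (n + n') p) = tmul R m (tmul S n p) + tmul R m (tmul S n' p)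
      rw [add_tmul, tmul_add])

/-- The map `M ⊗_R N → Hom(P, M ⊗_R (N ⊗_S P))` sending `m ⊗ n` to `p ↦ m ⊗ (n ⊗ p)`. -/
def assocAux₂ : TensorOver R M N →+ P →+ TensorOver R M (TensorOver S N P) :=
  lift
    (AddMonoidHom.mk' (assocAux₁ R S M N P) (fun m m' => by
      refine AddMonoidHom.ext fun n => AddMonoidHom.ext fun p => ?_
      change tmul R (m + m') (tmul S n p) = tmul R m (tmul S n p) + tmul R m' (tmul S n p)
      rw [add_tmul]))
    (fun m r n => AddMonoidHom.ext fun p => by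
      change tmul R (op r • m) (tmul S n p) = tmul R m (tmul S (r • n) p)
      rw [smul_tmul, left_smul_tmul])

/-- The associativity map `(M ⊗_R N) ⊗_S P → M ⊗_R (N ⊗_S P)`. -/
def assoc : TensorOver S (TensorOver R M N) P →+ TensorOver R M (TensorOver S N P) :=
  lift (assocAux₂ R S M N P)
    (fun x s p => by
      induction x using induction_on with
      | h0 => rw [smul_zero, map_zero, AddMonoidHom.zero_apply, AddMonoidHom.zero_apply]
      | ht m n =>
        change tmul R m (tmul S (op s • n) p) = tmul R m (tmul S n (s • p))
        rw [smul_tmul]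
      | ha x y hx hy => rw [smul_add, map_add, map_add, AddMonoidHom.add_apply,
          AddMonoidHom.add_apply, hx, hy])

@[simp]
theorem assoc_tmul (m : M) (n : N) (p : P) :
    assoc R S M N P (tmul S (tmul R m n) p) = tmul R m (tmul S n p) := rfl

/-- The map `N ⊗_S P → (M ⊗_R N) ⊗_S P` sending `n ⊗ p` to `(m ⊗ n) ⊗ p`. -/
def assocInvAux (m : M) : TensorOver S N P →+ TensorOver S (TensorOver R M N) P :=
  lift
    (AddMonoidHom.mk' (fun n => AddMonoidHom.mk' (fun p => tmul S (tmul R m n) p)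
        (fun p p' => tmul_add _ p p'))
      (fun n n' => AddMonoidHom.ext fun p => by
        change tmul S (tmul R m (n + n')) p = tmul S (tmul R m n) p + tmul S (tmul R m n') p
        rw [tmul_add, add_tmul]))
    (fun n s p => by
      change tmul S (tmul R m (op s • n)) p = tmul S (tmul R m n) (s • p)
      rw [← right_smul_tmul, smul_tmul])

/-- The inverse associativity map `M ⊗_R (N ⊗_S P) → (M ⊗_R N) ⊗_S P`. -/
def assocInv : TensorOver R M (TensorOver S N P) →+ TensorOver S (TensorOver R M N) P :=
  lift
    (AddMonoidHom.mk' (assocInvAux R S M N P) (fun m m' => hom_ext fun n p => by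
      change tmul S (tmul R (m + m') n) p = tmul S (tmul R m n) p + tmul S (tmul R m' n) p
      rw [add_tmul, add_tmul]))
    (fun m r x => by
      induction x using induction_on with
      | h0 => rw [smul_zero, map_zero, map_zero]
      | ht n p =>
        change tmul S (tmul R (op r • m) n) p = tmul S (tmul R m (r • n)) p
        rw [smul_tmul]
      | ha x y hx hy => rw [smul_add, map_add, map_add, hx, hy])

@[simp]
theorem assocInv_tmul (m : M) (n : N) (p : P) :
    assocInv R S M N P (tmul R m (tmul S n p)) = tmul S (tmul R m n) p := rfl

theorem assocInv_smul {T : Type*} [Ring T] [Module Tᵐᵒᵖ P] [SMulCommClass S Tᵐᵒᵖ P]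
    (t : Tᵐᵒᵖ) (x : TensorOver R M (TensorOver S N P)) :
    assocInv R S M N P (t • x) = t • assocInv R S M N P x := by
  induction x using induction_on with
  | h0 => simp
  | ht m y =>
    induction y using induction_on with
    | h0 => simp [tmul_zero]
    | ht n p => simp
    | ha y y' hy hy' => simp only [tmul_add, smul_add, map_add, hy, hy']
  | ha x y hx hy => simp only [smul_add, map_add, hx, hy]

theorem assocInv_assoc (x : TensorOver S (TensorOver R M N) P) :
    assocInv R S M N P (assoc R S M N P x) = x := by
  induction x using induction_on with
  | h0 => simp
  | ht y p =>
    induction y using induction_on with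
    | h0 => simp [zero_tmul]
    | ht m n => simp
    | ha y y' hy hy' => simp only [add_tmul, map_add, hy, hy']
  | ha x y hx hy => simp only [map_add, hx, hy]

end Assoc

end TensorOver

/-- A left `R`-module `P` is flat if `- ⊗_R P` preserves injectivity of maps of right
`R`-modules. -/
def LeftFlat (R : Type u) [Ring R] (P : Type u) [AddCommGroup P] [Module R P] : Prop :=
  ∀ (X Y : Type u) [AddCommGroup X] [Module Rᵐᵒᵖ X] [AddCommGroup Y] [Module Rᵐᵒᵖ Y]
    (f : X →ₗ[Rᵐᵒᵖ] Y), Function.Injective f →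
      Function.Injective (TensorOver.map f (LinearMap.id : P →ₗ[R] P))

/-! ## Corings and bicomodules -/

/-- An `(R, S)`-bilinear map. -/
structure BimodHom (R S : Type*) [Ring R] [Ring S] (M N : Type*) [AddCommGroup M] [Module R M]
    [Module Sᵐᵒᵖ M] [AddCommGroup N] [Module R N] [Module Sᵐᵒᵖ N] where
  /-- the map, as a map of left modules -/
  left : M →ₗ[R] N
  map_op_smul' : ∀ (s : Sᵐᵒᵖ) (m : M), left (s • m) = s • left m

namespace BimodHom

variable {R S : Type*} [Ring R] [Ring S] {M N : Type*} [AddCommGroup M] [Module R M]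
    [Module Sᵐᵒᵖ M] [AddCommGroup N] [Module R N] [Module Sᵐᵒᵖ N]

/-- A bilinear map as a map of right modules. -/
def right (f : BimodHom R S M N) : M →ₗ[Sᵐᵒᵖ] N where
  toFun := f.left
  map_add' := map_add f.left
  map_smul' := f.map_op_smul'

instance : CoeFun (BimodHom R S M N) (fun _ => M → N) := ⟨fun f => f.left⟩

@[simp]
theorem right_apply (f : BimodHom R S M N) (m : M) : f.right m = f m := rfl

end BimodHom

/-- The structure of an `A`-coring on an `(A, A)`-bimodule `C`. -/
class Coring (A : Type*) [Ring A] (C : Type*) [AddCommGroup C] [Module A C] [Module Aᵐᵒᵖ C]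
    [SMulCommClass A Aᵐᵒᵖ C] where
  /-- the comultiplication `C → C ⊗_A C` -/
  comul : BimodHom A A C (TensorOver A C C)
  /-- the counit `C → A` -/
  counit : BimodHom A A C A
  coassoc : ∀ c : C,
    TensorOver.assoc A A C C C (TensorOver.map comul.right LinearMap.id (comul c)) =
      TensorOver.map LinearMap.id comul.left (comul c)
  counit_left : ∀ c : C,
    TensorOver.lid A C (TensorOver.map counit.right LinearMap.id (comul c)) = c
  counit_right : ∀ c : C,
    TensorOver.rid A C (TensorOver.map LinearMap.id counit.left (comul c)) = c

/-- The structure of a `(C, D)`-bicomodule on an `(A, B)`-bimodule `N`, for an `A`-coring `C` and a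
`B`-coring `D`: commuting left `C`-comodule and right `D`-comodule structures by bilinear maps. -/
class Bicomodule (A C B D N : Type*) [Ring A] [AddCommGroup C] [Module A C] [Module Aᵐᵒᵖ C]
    [SMulCommClass A Aᵐᵒᵖ C] [Coring A C] [Ring B] [AddCommGroup D] [Module B D] [Module Bᵐᵒᵖ D]
    [SMulCommClass B Bᵐᵒᵖ D] [Coring B D] [AddCommGroup N] [Module A N] [Module Bᵐᵒᵖ N]
    [SMulCommClass A Bᵐᵒᵖ N] where
  /-- the left coaction `N → C ⊗_A N` -/
  coactL : BimodHom A B N (TensorOver A C N)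
  /-- the right coaction `N → N ⊗_B D` -/
  coactR : BimodHom A B N (TensorOver B N D)
  coassocL : ∀ n : N,
    TensorOver.assoc A A C C N
        (TensorOver.map (Coring.comul (A := A) (C := C)).right LinearMap.id (coactL n)) =
      TensorOver.map LinearMap.id coactL.left (coactL n)
  counitL : ∀ n : N,
    TensorOver.lid A N
      (TensorOver.map (Coring.counit (A := A) (C := C)).right LinearMap.id (coactL n)) = n
  coassocR : ∀ n : N,
    TensorOver.assoc B B N D D (TensorOver.map coactR.right LinearMap.id (coactR n)) =
      TensorOver.map LinearMap.id (Coring.comul (A := B) (C := D)).left (coactR n)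
  counitR : ∀ n : N,
    TensorOver.rid B N
      (TensorOver.map LinearMap.id (Coring.counit (A := B) (C := D)).left (coactR n)) = n
  coact_comm : ∀ n : N,
    TensorOver.assoc A B C N D (TensorOver.map coactL.right LinearMap.id (coactR n)) =
      TensorOver.map LinearMap.id coactR.left (coactL n)


/-! ## Hom modules and the monad `[C, -]` -/

/-- The right `T`-linear maps `N → X`. For an `(A, T)`-bimodule `N` this is a right `A`-module by
`(f a)(n) = f (a n)`. -/
def RHom (T : Type*) [Ring T] (N : Type*) [AddCommGroup N] [Module Tᵐᵒᵖ N] (X : Type*)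
    [AddCommGroup X] [Module Tᵐᵒᵖ X] : Type _ :=
  N →ₗ[Tᵐᵒᵖ] X

namespace RHom

section

variable {T : Type*} [Ring T] {N : Type*} [AddCommGroup N] [Module Tᵐᵒᵖ N] {X : Type*}
    [AddCommGroup X] [Module Tᵐᵒᵖ X]

instance : AddCommGroup (RHom T N X) := inferInstanceAs (AddCommGroup (N →ₗ[Tᵐᵒᵖ] X))

instance : FunLike (RHom T N X) N X := inferInstanceAs (FunLike (N →ₗ[Tᵐᵒᵖ] X) N X)

instance : LinearMapClass (RHom T N X) Tᵐᵒᵖ N X :=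
  inferInstanceAs (LinearMapClass (N →ₗ[Tᵐᵒᵖ] X) Tᵐᵒᵖ N X)

/-- An element of `RHom T N X` as a linear map. -/
def lin (f : RHom T N X) : N →ₗ[Tᵐᵒᵖ] X := f

/-- A linear map as an element of `RHom T N X`. -/
def ofLin (f : N →ₗ[Tᵐᵒᵖ] X) : RHom T N X := f

@[simp] theorem lin_apply (f : RHom T N X) (n : N) : f.lin n = f n := rfl

@[simp] theorem ofLin_apply (f : N →ₗ[Tᵐᵒᵖ] X) (n : N) : ofLin f n = f n := rfl

@[simp] theorem add_apply (f g : RHom T N X) (n : N) : (f + g) n = f n + g n := rfl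

@[simp] theorem zero_apply (n : N) : (0 : RHom T N X) n = 0 := rfl

@[ext] theorem ext {f g : RHom T N X} (h : ∀ n, f n = g n) : f = g := LinearMap.ext h

instance {A : Type*} [Ring A] [Module A N] [SMulCommClass A Tᵐᵒᵖ N] :
    Module Aᵐᵒᵖ (RHom T N X) where
  smul a f := ofLin (f.lin.comp (DistribSMul.toLinearMap Tᵐᵒᵖ N a.unop))
  one_smul f := ext fun n => congrArg f (one_smul A n)
  mul_smul a b f := ext fun n => congrArg f (mul_smul b.unop a.unop n)
  smul_zero _ := rfl
  smul_add _ _ _ := rfl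
  add_smul a b f := ext fun n => by
    change f ((a.unop + b.unop) • n) = f (a.unop • n) + f (b.unop • n)
    rw [add_smul, map_add]
  zero_smul f := ext fun n => by
    change f ((0 : A) • n) = 0
    rw [zero_smul, map_zero]

@[simp] theorem smul_apply {A : Type*} [Ring A] [Module A N] [SMulCommClass A Tᵐᵒᵖ N]
    (a : Aᵐᵒᵖ) (f : RHom T N X) (n : N) : (a • f) n = f (a.unop • n) := rfl

end

section

variable {A T : Type*} [Ring A] [Ring T] {C : Type*} [AddCommGroup C] [Module Aᵐᵒᵖ C]
    {N : Type*} [AddCommGroup N] [Module A N] [Module Tᵐᵒᵖ N]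
    [SMulCommClass A Tᵐᵒᵖ N] {X : Type*} [AddCommGroup X] [Module Tᵐᵒᵖ X]

/-- The additive map `C ⊗_A N → X`, `c ⊗ n ↦ h(c)(n)`, for `h` in `Hom_A(C, Hom_T(N, X))`. -/
def evAdd (h : RHom A C (RHom T N X)) : TensorOver A C N →+ X :=
  TensorOver.lift
    (AddMonoidHom.mk' (fun c => AddMonoidHom.mk' (fun n => h c n) (fun n n' => map_add (h c) n n'))
      (fun c c' => AddMonoidHom.ext fun n => by
        change h (c + c') n = h c n + h c' n
        rw [map_add, add_apply]))
    (fun c a n => by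
      change h (op a • c) n = h c (a • n)
      rw [map_smul, smul_apply, unop_op])

theorem evAdd_tmul (h : RHom A C (RHom T N X)) (c : C) (n : N) :
    evAdd h (TensorOver.tmul A c n) = h c n := rfl

theorem evAdd_smul (h : RHom A C (RHom T N X)) (t : Tᵐᵒᵖ) (x : TensorOver A C N) :
    evAdd h (t • x) = t • evAdd h x := by
  induction x using TensorOver.induction_on with
  | h0 => rw [smul_zero, map_zero, smul_zero]
  | ht c n => exact map_smul (h c) t n
  | ha x y hx hy => rw [smul_add, map_add, map_add, hx, hy, smul_add]

theorem evAdd_add (h h' : RHom A C (RHom T N X)) (x : TensorOver A C N) :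
    evAdd (h + h') x = evAdd h x + evAdd h' x := by
  induction x using TensorOver.induction_on with
  | h0 => rw [map_zero, map_zero, map_zero, add_zero]
  | ht c n => rfl
  | ha x y hx hy => rw [map_add, map_add, map_add, hx, hy]; abel

/-- The right `T`-linear map `C ⊗_A N → X`, `c ⊗ n ↦ h(c)(n)`. -/
def evLin (h : RHom A C (RHom T N X)) : TensorOver A C N →ₗ[Tᵐᵒᵖ] X :=
  { evAdd h with map_smul' := evAdd_smul h }

@[simp]
theorem evLin_tmul (h : RHom A C (RHom T N X)) (c : C) (n : N) :
    evLin h (TensorOver.tmul A c n) = h c n := rfl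

variable [Module A C] [SMulCommClass A Aᵐᵒᵖ C]

theorem evAdd_smul' (a : Aᵐᵒᵖ) (h : RHom A C (RHom T N X)) (x : TensorOver A C N) :
    evAdd (a • h) x = evAdd h (a.unop • x) := by
  induction x using TensorOver.induction_on with
  | h0 => rw [smul_zero, map_zero, map_zero]
  | ht c n => rfl
  | ha x y hx hy => rw [smul_add, map_add, map_add, hx, hy]

/-- The map `Hom_A(C, Hom_T(N, X)) → Hom_T(C ⊗_A N, X)`, `h ↦ (c ⊗ n ↦ h(c)(n))`. -/
def ev : RHom A C (RHom T N X) →ₗ[Aᵐᵒᵖ] RHom T (TensorOver A C N) X where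
  toFun h := ofLin (evLin h)
  map_add' h h' := ext (evAdd_add h h')
  map_smul' a h := ext (evAdd_smul' a h)

@[simp]
theorem ev_tmul (h : RHom A C (RHom T N X)) (c : C) (n : N) :
    ev h (TensorOver.tmul A c n) = h c n := rfl

/-- For a bilinear map `ρ : N → C ⊗_A N`, the map `Hom_A(C, Hom_T(N, X)) → Hom_T(N, X)` sending `h`
to the composite of `ρ` with `c ⊗ n ↦ h(c)(n)`. -/
def contract (ρ : BimodHom A T N (TensorOver A C N)) :
    RHom A C (RHom T N X) →ₗ[Aᵐᵒᵖ] RHom T N X where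
  toFun h := ofLin ((ev h).lin.comp ρ.right)
  map_add' h h' := ext fun n => by simp
  map_smul' a h := ext fun n => by
    simp

@[simp]
theorem contract_apply (ρ : BimodHom A T N (TensorOver A C N)) (h : RHom A C (RHom T N X))
    (n : N) : contract ρ h n = ev h (ρ n) := rfl

theorem contract_contract (Δ : BimodHom A A C (TensorOver A C C))
    (ρ : BimodHom A T N (TensorOver A C N))
    (hρ : ∀ n, TensorOver.assoc A A C C N (TensorOver.map Δ.right LinearMap.id (ρ n)) =
      TensorOver.map LinearMap.id ρ.left (ρ n))
    (k : RHom A C (RHom A C (RHom T N X))) :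
    contract ρ (contract Δ k) = contract ρ (ofLin ((contract ρ).comp k.lin)) := by
  have h1 (t : TensorOver A C N) :
      ev (contract Δ k) t = ev (ev k) (TensorOver.map Δ.right LinearMap.id t) := by
    induction t using TensorOver.induction_on with
    | h0 => simp
    | ht c n => rfl
    | ha x y hx hy => simp only [map_add, hx, hy]
  have h2 (t : TensorOver A C N) : ev (ofLin ((contract ρ).comp k.lin)) t =
      ev (ofLin (ev.comp k.lin)) (TensorOver.map LinearMap.id ρ.left t) := by
    induction t using TensorOver.induction_on with
    | h0 => simp
    | ht c n => rfl
    | ha x y hx hy => simp only [map_add, hx, hy]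
  have h3 (t : TensorOver A (TensorOver A C C) N) :
      ev (ev k) t = ev (ofLin (ev.comp k.lin)) (TensorOver.assoc A A C C N t) := by
    induction t using TensorOver.induction_on with
    | h0 => simp
    | ht s n =>
      induction s using TensorOver.induction_on with
      | h0 => simp [TensorOver.zero_tmul]
      | ht c c' => rfl
      | ha x y hx hy => simp only [TensorOver.add_tmul, map_add, hx, hy]
    | ha x y hx hy => simp only [map_add, hx, hy]
  ext n
  rw [contract_apply, contract_apply, h1, h2, h3, hρ]

/-- For a bilinear map `ε : C → A`, the map `X → Hom_A(C, X)`, `x ↦ (c ↦ x ε(c))`. -/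
def const {X : Type*} [AddCommGroup X] [Module Aᵐᵒᵖ X] (ε : BimodHom A A C A) :
    X →ₗ[Aᵐᵒᵖ] RHom A C X where
  toFun x := ofLin
    { toFun := fun c => op (ε c) • x
      map_add' := fun c c' => by simp [add_smul]
      map_smul' := fun a c => by
        rw [ε.map_op_smul']
        simp [mul_smul] }
  map_add' x y := ext fun c => smul_add _ x y
  map_smul' a x := ext fun c => by
    change op (ε c) • a • x = op (ε (a.unop • c)) • x
    rw [map_smul, smul_eq_mul, op_mul, mul_smul, op_unop]

@[simp]
theorem const_apply {X : Type*} [AddCommGroup X] [Module Aᵐᵒᵖ X] (ε : BimodHom A A C A) (x : X)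
    (c : C) : const ε x c = op (ε c) • x := rfl

theorem contract_const (ε : BimodHom A A C A) (ρ : BimodHom A T N (TensorOver A C N))
    (hε : ∀ n, TensorOver.lid A N (TensorOver.map ε.right LinearMap.id (ρ n)) = n)
    (f : RHom T N X) : contract ρ (const ε f) = f := by
  have h1 (t : TensorOver A C N) : ev (const ε f) t =
      f (TensorOver.lid A N (TensorOver.map ε.right LinearMap.id t)) := by
    induction t using TensorOver.induction_on with
    | h0 => simp
    | ht c n => rfl
    | ha x y hx hy => simp only [map_add, hx, hy]
  ext n
  rw [contract_apply, h1, hε]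

/-- Composition with a linear map `X → Y`, as a map `Hom_T(N, X) → Hom_T(N, Y)`. -/
def postcomp {Y : Type*} [AddCommGroup Y] [Module Tᵐᵒᵖ Y] (g : X →ₗ[Tᵐᵒᵖ] Y) :
    RHom T N X →ₗ[Aᵐᵒᵖ] RHom T N Y where
  toFun f := ofLin (g.comp f.lin)
  map_add' _ _ := ext fun _ => map_add g _ _
  map_smul' _ _ := rfl

@[simp]
theorem postcomp_apply {Y : Type*} [AddCommGroup Y] [Module Tᵐᵒᵖ Y] (g : X →ₗ[Tᵐᵒᵖ] Y)
    (f : RHom T N X) (n : N) : postcomp (A := A) g f n = g (f n) := rfl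

theorem contract_postcomp {Y : Type*} [AddCommGroup Y] [Module Tᵐᵒᵖ Y] (g : X →ₗ[Tᵐᵒᵖ] Y)
    (ρ : BimodHom A T N (TensorOver A C N)) (h : RHom A C (RHom T N X)) :
    contract ρ (postcomp (A := A) (postcomp (A := A) g) h) =
      postcomp (A := A) g (contract ρ h) := by
  ext n
  rw [postcomp_apply, contract_apply, contract_apply]
  generalize ρ n = t
  induction t using TensorOver.induction_on with
  | h0 => simp only [map_zero]
  | ht c n => rfl
  | ha x y hx hy => rw [map_add, hx, hy, map_add, map_add]

end

end RHom

section Monad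

variable (A C : Type u) [Ring A] [AddCommGroup C] [Module A C] [Module Aᵐᵒᵖ C]
    [SMulCommClass A Aᵐᵒᵖ C] [Coring A C]

/-- The monad `[C, -] = Hom_A(C, -)` on right `A`-modules given by an `A`-coring `C`. -/
def contraMonad : Monad (ModuleCat.{u} Aᵐᵒᵖ) where
  obj X := ModuleCat.of Aᵐᵒᵖ (RHom A C X)
  map f := ModuleCat.ofHom (RHom.postcomp (A := A) f.hom)
  map_id _ := rfl
  map_comp _ _ := rfl
  η :=
    { app := fun X => ModuleCat.ofHom (RHom.const Coring.counit)
      naturality := fun X Y f => by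
        ext x c
        exact (map_smul f.hom _ x).symm }
  μ :=
    { app := fun X => ModuleCat.ofHom (RHom.contract Coring.comul)
      naturality := fun X Y f => by
        ext h c
        exact DFunLike.congr_fun (RHom.contract_postcomp f.hom Coring.comul h) c }
  assoc X := by
    ext k c
    exact DFunLike.congr_fun
      (RHom.contract_contract Coring.comul Coring.comul Coring.coassoc k).symm c
  left_unit X := by
    ext f c
    exact DFunLike.congr_fun
      (RHom.contract_const Coring.counit Coring.comul Coring.counit_left f) c
  right_unit X := by
    ext f c
    have h1 (t : TensorOver A C C) :
        RHom.ev (RHom.postcomp (A := A) (RHom.const Coring.counit) f) t =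
          f (TensorOver.rid A C (TensorOver.map LinearMap.id
            (Coring.counit (A := A) (C := C)).left t)) := by
      induction t using TensorOver.induction_on with
      | h0 => simp
      | ht c n => exact (map_smul f _ _).symm
      | ha x y hx hy => simp only [map_add, hx, hy]
    exact (h1 _).trans (congrArg f (Coring.counit_right c))

/-- The category `M_{[C,-]}` of (right) `C`-contramodules: modules of the monad `[C, -]`. -/
abbrev Contramod := (contraMonad A C).Algebra

variable {A C} in
/-- The contraaction `Hom_A(C, M) → M` of a contramodule `M`. -/
def contraact (M : Contramod A C) : RHom A C M.A →ₗ[Aᵐᵒᵖ] M.A := M.a.hom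

end Monad

/-! ## The comonad `- ⊗_B D` and comodules -/

section Comonad

variable {A B : Type*} [Ring A] [Ring B] {D : Type*} [AddCommGroup D] [Module B D] [Module Bᵐᵒᵖ D]
    [SMulCommClass B Bᵐᵒᵖ D] {N : Type*} [AddCommGroup N] [Module A N] [Module Bᵐᵒᵖ N]
    [SMulCommClass A Bᵐᵒᵖ N]

/-- For a bilinear map `ρ : N → N ⊗_B D`, the map `X ⊗_A ρ : X ⊗_A N → (X ⊗_A N) ⊗_B D`. -/
def coactOn (X : Type*) [AddCommGroup X] [Module Aᵐᵒᵖ X] (ρ : BimodHom A B N (TensorOver B N D)) :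
    TensorOver A X N →ₗ[Bᵐᵒᵖ] TensorOver B (TensorOver A X N) D :=
  { (TensorOver.assocInv A B X N D).comp (TensorOver.map LinearMap.id ρ.left) with
    map_smul' := fun b t => by
      change TensorOver.assocInv A B X N D (TensorOver.map LinearMap.id ρ.left (b • t)) =
        b • TensorOver.assocInv A B X N D (TensorOver.map LinearMap.id ρ.left t)
      rw [← TensorOver.assocInv_smul]
      congr 1
      induction t using TensorOver.induction_on with
      | h0 => simp
      | ht x n => simp [ρ.map_op_smul']
      | ha x y hx hy => simp only [smul_add, map_add, hx, hy] }

theorem coactOn_apply (X : Type*) [AddCommGroup X] [Module Aᵐᵒᵖ X]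
    (ρ : BimodHom A B N (TensorOver B N D)) (t : TensorOver A X N) :
    coactOn X ρ t = TensorOver.assocInv A B X N D (TensorOver.map LinearMap.id ρ.left t) := rfl

theorem coactOn_tmul (X : Type*) [AddCommGroup X] [Module Aᵐᵒᵖ X]
    (ρ : BimodHom A B N (TensorOver B N D)) (x : X) (n : N) :
    coactOn X ρ (TensorOver.tmul A x n) =
      TensorOver.assocInv A B X N D (TensorOver.tmul A x (ρ n)) := rfl

theorem coactOn_naturality {X Y : Type*} [AddCommGroup X] [Module Aᵐᵒᵖ X] [AddCommGroup Y]
    [Module Aᵐᵒᵖ Y] (f : X →ₗ[Aᵐᵒᵖ] Y) (ρ : BimodHom A B N (TensorOver B N D))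
    (t : TensorOver A X N) :
    coactOn Y ρ (TensorOver.rmap B N f t) =
      TensorOver.rmap B D (TensorOver.rmap B N f) (coactOn X ρ t) := by
  induction t using TensorOver.induction_on with
  | h0 => simp
  | ht x n =>
    rw [TensorOver.rmap_tmul, coactOn_tmul, coactOn_tmul]
    generalize ρ n = s
    induction s using TensorOver.induction_on with
    | h0 => simp [TensorOver.tmul_zero]
    | ht n d => rfl
    | ha x y hx hy => simp only [TensorOver.tmul_add, map_add, hx, hy]
  | ha x y hx hy => simp only [map_add, hx, hy]

theorem coactOn_coassoc (X : Type*) [AddCommGroup X] [Module Aᵐᵒᵖ X]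
    (Δ : BimodHom B B D (TensorOver B D D)) (ρ : BimodHom A B N (TensorOver B N D))
    (hρ : ∀ n, TensorOver.assoc B B N D D (TensorOver.map ρ.right LinearMap.id (ρ n)) =
      TensorOver.map LinearMap.id Δ.left (ρ n)) (t : TensorOver A X N) :
    coactOn (TensorOver A X N) Δ (coactOn X ρ t) =
      TensorOver.rmap B D (coactOn X ρ) (coactOn X ρ t) := by
  induction t using TensorOver.induction_on with
  | h0 => simp
  | ht x n =>
    rw [coactOn_tmul]
    let ι : N →ₗ[Bᵐᵒᵖ] TensorOver A X N :=
      { toFun := TensorOver.tmul A x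
        map_add' := TensorOver.tmul_add x
        map_smul' := fun _ _ => rfl }
    have hn : TensorOver.map ρ.right LinearMap.id (ρ n) =
        TensorOver.assocInv B B N D D (TensorOver.map LinearMap.id Δ.left (ρ n)) := by
      rw [← hρ, TensorOver.assocInv_assoc]
    have h1 (s : TensorOver B N D) :
        coactOn (TensorOver A X N) Δ (TensorOver.assocInv A B X N D (TensorOver.tmul A x s)) =
          TensorOver.map (TensorOver.rmap B D ι) LinearMap.id
            (TensorOver.assocInv B B N D D (TensorOver.map LinearMap.id Δ.left s)) := by
      induction s using TensorOver.induction_on with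
      | h0 => simp [TensorOver.tmul_zero]
      | ht n d =>
        rw [TensorOver.assocInv_tmul, coactOn_tmul, TensorOver.map_tmul, LinearMap.id_apply]
        generalize Δ.left d = s
        induction s using TensorOver.induction_on with
        | h0 => simp [TensorOver.tmul_zero]
        | ht n d => rfl
        | ha x y hx hy => simp only [TensorOver.tmul_add, map_add, hx, hy]
      | ha x y hx hy => simp only [TensorOver.tmul_add, map_add, hx, hy]
    have h2 (s : TensorOver B N D) :
        TensorOver.assocInv A B X N D (TensorOver.tmul A x s) = TensorOver.rmap B D ι s := by
      induction s using TensorOver.induction_on with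
      | h0 => simp [TensorOver.tmul_zero]
      | ht n d => rfl
      | ha x y hx hy => simp only [TensorOver.tmul_add, map_add, hx, hy]
    have h3 (s : TensorOver B N D) :
        TensorOver.rmap B D (coactOn X ρ)
            (TensorOver.assocInv A B X N D (TensorOver.tmul A x s)) =
          TensorOver.map (TensorOver.rmap B D ι) LinearMap.id
            (TensorOver.map ρ.right LinearMap.id s) := by
      induction s using TensorOver.induction_on with
      | h0 => simp [TensorOver.tmul_zero]
      | ht n d =>
        rw [TensorOver.assocInv_tmul, TensorOver.rmap_tmul, TensorOver.map_tmul,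
          TensorOver.map_tmul, coactOn_tmul, h2]
        rfl
      | ha x y hx hy => simp only [TensorOver.tmul_add, map_add, hx, hy]
    rw [h1, h3, hn]
  | ha x y hx hy => simp only [map_add, hx, hy]

/-- For a bilinear map `ε : D → B`, the map `X ⊗_B ε : X ⊗_B D → X`. -/
def counitOn (X : Type*) [AddCommGroup X] [Module Bᵐᵒᵖ X] (ε : BimodHom B B D B) :
    TensorOver B X D →ₗ[Bᵐᵒᵖ] X :=
  { (TensorOver.rid B X).comp (TensorOver.map LinearMap.id ε.left) with
    map_smul' := fun b t => by
      change TensorOver.rid B X (TensorOver.map LinearMap.id ε.left (b • t)) =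
        b • TensorOver.rid B X (TensorOver.map LinearMap.id ε.left t)
      induction t using TensorOver.induction_on with
      | h0 => simp
      | ht x n => simp [ε.map_op_smul', mul_smul]
      | ha x y hx hy => simp only [smul_add, map_add, hx, hy] }

@[simp]
theorem counitOn_tmul (X : Type*) [AddCommGroup X] [Module Bᵐᵒᵖ X] (ε : BimodHom B B D B) (x : X)
    (d : D) : counitOn X ε (TensorOver.tmul B x d) = op (ε d) • x := rfl

theorem coactOn_counit (X : Type*) [AddCommGroup X] [Module Aᵐᵒᵖ X]
    (ε : BimodHom B B D B) (ρ : BimodHom A B N (TensorOver B N D))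
    (hε : ∀ n, TensorOver.rid B N (TensorOver.map LinearMap.id ε.left (ρ n)) = n)
    (t : TensorOver A X N) : counitOn (TensorOver A X N) ε (coactOn X ρ t) = t := by
  induction t using TensorOver.induction_on with
  | h0 => simp
  | ht x n =>
    have h1 (s : TensorOver B N D) :
        counitOn (TensorOver A X N) ε (TensorOver.assocInv A B X N D (TensorOver.tmul A x s)) =
          TensorOver.tmul A x (TensorOver.rid B N (TensorOver.map LinearMap.id ε.left s)) := by
      induction s using TensorOver.induction_on with
      | h0 => simp [TensorOver.tmul_zero]
      | ht n d => rfl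
      | ha x y hx hy => simp only [TensorOver.tmul_add, map_add, hx, hy]
    rw [coactOn_tmul, h1, hε]
  | ha x y hx hy => simp only [map_add, hx, hy]

end Comonad

section Comodules

variable (B D : Type u) [Ring B] [AddCommGroup D] [Module B D] [Module Bᵐᵒᵖ D]
    [SMulCommClass B Bᵐᵒᵖ D] [Coring B D]

/-- The comonad `- ⊗_B D` on right `B`-modules given by a `B`-coring `D`. -/
def tensorComonad : Comonad (ModuleCat.{u} Bᵐᵒᵖ) where
  obj X := ModuleCat.of Bᵐᵒᵖ (TensorOver B X D)
  map f := ModuleCat.ofHom (TensorOver.rmap B D f.hom)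
  map_id X := by
    ext t
    exact DFunLike.congr_fun TensorOver.map_id t
  map_comp f g := by
    ext t
    induction t using TensorOver.induction_on with
    | h0 => rw [map_zero, map_zero]
    | ht x d => rfl
    | ha x y hx hy => rw [map_add, hx, hy, map_add]
  ε :=
    { app := fun X => ModuleCat.ofHom (counitOn X Coring.counit)
      naturality := fun X Y f => by
        ext t
        induction t using TensorOver.induction_on with
        | h0 => rw [map_zero, map_zero]
        | ht x d => exact (map_smul f.hom _ x).symm
        | ha x y hx hy => rw [map_add, hx, hy, map_add] }
  δ :=
    { app := fun X => ModuleCat.ofHom (coactOn X Coring.comul)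
      naturality := fun X Y f => by
        ext t
        exact coactOn_naturality f.hom Coring.comul t }
  coassoc X := by
    ext t
    exact (coactOn_coassoc X Coring.comul Coring.comul Coring.coassoc t).symm
  left_counit X := by
    ext t
    exact coactOn_counit X Coring.counit Coring.comul Coring.counit_right t
  right_counit X := by
    ext t
    change TensorOver.rmap B D (counitOn X Coring.counit) (coactOn X Coring.comul t) = t
    induction t using TensorOver.induction_on with
    | h0 => rw [map_zero, map_zero]
    | ht x d =>
      have h1 (s : TensorOver B D D) :
          TensorOver.rmap B D (counitOn X Coring.counit)
              (TensorOver.assocInv B B X D D (TensorOver.tmul B x s)) =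
            TensorOver.tmul B x (TensorOver.lid B D
              (TensorOver.map (Coring.counit (A := B) (C := D)).right LinearMap.id s)) := by
        induction s using TensorOver.induction_on with
        | h0 => simp [TensorOver.tmul_zero]
        | ht n d => exact TensorOver.smul_tmul x _ d
        | ha x y hx hy => simp only [TensorOver.tmul_add, map_add, hx, hy]
      rw [coactOn_tmul, h1, Coring.counit_left]
    | ha x y hx hy => rw [map_add, map_add, hx, hy]

/-- The category `M^D` of right `D`-comodules: comodules of the comonad `- ⊗_B D`. -/
abbrev Comod := (tensorComonad B D).Coalgebra

variable {B D} in
/-- The coaction `Q → Q ⊗_B D` of a right comodule `Q`. -/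
def coact (Q : Comod B D) : Q.A →ₗ[Bᵐᵒᵖ] TensorOver B Q.A D := Q.a.hom

end Comodules


/-! ## The functors induced by a bicomodule -/

section Bicomodules

variable (A C B D N : Type u) [Ring A] [AddCommGroup C] [Module A C] [Module Aᵐᵒᵖ C]
    [SMulCommClass A Aᵐᵒᵖ C] [Coring A C] [Ring B] [AddCommGroup D] [Module B D] [Module Bᵐᵒᵖ D]
    [SMulCommClass B Bᵐᵒᵖ D] [Coring B D] [AddCommGroup N] [Module A N] [Module Bᵐᵒᵖ N]
    [SMulCommClass A Bᵐᵒᵖ N] [Bicomodule A C B D N]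

namespace Bicomodule

/-- The left coaction `N → C ⊗_A N` of a bicomodule. -/
def rhoL : BimodHom A B N (TensorOver A C N) := coactL (A := A) (C := C) (B := B) (D := D)

/-- The right coaction `N → N ⊗_B D` of a bicomodule. -/
def rhoR : BimodHom A B N (TensorOver B N D) := coactR (A := A) (C := C) (B := B) (D := D)

/-- A bicomodule `N` as a right `D`-comodule. -/
def toComod : Comod B D where
  A := ModuleCat.of Bᵐᵒᵖ N
  a := ModuleCat.ofHom (rhoR A C B D N).right
  counit := by
    ext n
    exact counitR (A := A) (C := C) (B := B) (D := D) n
  coassoc := by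
    ext n
    refine (congrArg (TensorOver.assocInv B B N D D)
      (coassocR (A := A) (C := C) (B := B) (D := D) n).symm).trans ?_
    exact TensorOver.assocInv_assoc B B N D D _

/-- The right `D`-comodule `X ⊗_A N` with coaction `X ⊗_A ρ^N`, for a right `A`-module `X`. -/
def tensorComod (X : ModuleCat.{u} Aᵐᵒᵖ) : Comod B D where
  A := ModuleCat.of Bᵐᵒᵖ (TensorOver A X N)
  a := ModuleCat.ofHom (coactOn X (rhoR A C B D N))
  counit := by
    ext t
    exact coactOn_counit X Coring.counit (rhoR A C B D N)
      (counitR (A := A) (C := C) (B := B) (D := D)) t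
  coassoc := by
    ext t
    exact coactOn_coassoc X Coring.comul (rhoR A C B D N)
      (coassocR (A := A) (C := C) (B := B) (D := D)) t

/-- The `C`-contramodule `Hom_B(N, X)`, for a right `B`-module `X`, with contraaction
`h ↦ (n ↦ h(n₍₋₁₎)(n₍₀₎))`. -/
def homContra (X : ModuleCat.{u} Bᵐᵒᵖ) : Contramod A C where
  A := ModuleCat.of Aᵐᵒᵖ (RHom B N X)
  a := ModuleCat.ofHom (RHom.contract (rhoL A C B D N))
  unit := by
    ext f n
    exact DFunLike.congr_fun (RHom.contract_const Coring.counit (rhoL A C B D N)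
      (counitL (A := A) (C := C) (B := B) (D := D)) f) n
  assoc := by
    ext k n
    exact DFunLike.congr_fun (RHom.contract_contract Coring.comul (rhoL A C B D N)
      (coassocL (A := A) (C := C) (B := B) (D := D)) k) n

theorem coactOn_rhoL (n : N) :
    coactOn C (rhoR A C B D N) (rhoL A C B D N n) =
      TensorOver.map (rhoL A C B D N).right LinearMap.id (rhoR A C B D N n) := by
  rw [coactOn_apply]
  refine (congrArg (TensorOver.assocInv A B C N D)
    (coact_comm (A := A) (C := C) (B := B) (D := D) n).symm).trans ?_
  exact TensorOver.assocInv_assoc A B C N D _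

/-- The right `A`-module `Hom^D(N, Q)` of right `D`-comodule maps `N → Q`: the right `B`-linear maps
`f` with `ρ^Q ∘ f = (f ⊗_B D) ∘ ρ^N`. -/
def homD (Q : Comod B D) : Submodule Aᵐᵒᵖ (RHom B N Q.A) where
  carrier := {f | ∀ n : N,
    coact Q (f n) = TensorOver.map f.lin LinearMap.id (rhoR A C B D N n)}
  add_mem' {f g} hf hg n := by
    change coact Q (f n + g n) = _
    rw [map_add, hf n, hg n]
    generalize rhoR A C B D N n = t
    induction t using TensorOver.induction_on with
    | h0 => rw [map_zero, map_zero, map_zero, add_zero]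
    | ht m d => exact (TensorOver.add_tmul (f m) (g m) d).symm
    | ha x y hx hy => rw [map_add, map_add, map_add, ← hx, ← hy]; abel
  zero_mem' n := by
    change coact Q 0 = _
    rw [map_zero]
    generalize rhoR A C B D N n = t
    induction t using TensorOver.induction_on with
    | h0 => rw [map_zero]
    | ht m d => exact (TensorOver.zero_tmul d).symm
    | ha x y hx hy => rw [map_add, ← hx, ← hy, add_zero]
  smul_mem' a f hf n := by
    change coact Q (f (a.unop • n)) = _
    rw [hf, map_smul]
    generalize rhoR A C B D N n = t
    induction t using TensorOver.induction_on with
    | h0 => rw [smul_zero, map_zero, map_zero]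
    | ht m d => rfl
    | ha x y hx hy => rw [smul_add, map_add, map_add, hx, hy]

/-- Comodule maps form a subcontramodule: if `h` takes values in comodule maps, then so is
`n ↦ h(n₍₋₁₎)(n₍₀₎)`. -/
theorem contract_mem_homD (Q : Comod B D) (h : RHom A C (RHom B N Q.A))
    (hh : ∀ c, h c ∈ homD A C B D N Q) :
    RHom.contract (rhoL A C B D N) h ∈ homD A C B D N Q := by
  intro n
  have h1 (t : TensorOver A C N) : coact Q (RHom.ev h t) =
      TensorOver.map (RHom.ev h).lin LinearMap.id (coactOn C (rhoR A C B D N) t) := by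
    induction t using TensorOver.induction_on with
    | h0 => simp only [map_zero]
    | ht c n =>
      rw [RHom.ev_tmul, hh c n, coactOn_tmul]
      generalize rhoR A C B D N n = s
      induction s using TensorOver.induction_on with
      | h0 => rw [TensorOver.tmul_zero, map_zero, map_zero, map_zero]
      | ht n d => rfl
      | ha x y hx hy => rw [TensorOver.tmul_add, map_add, map_add, map_add, hx, hy]
    | ha x y hx hy => simp only [map_add, hx, hy]
  rw [RHom.contract_apply, h1, coactOn_rhoL]
  generalize rhoR A C B D N n = s
  induction s using TensorOver.induction_on with
  | h0 => simp only [map_zero]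
  | ht n d => rfl
  | ha x y hx hy => simp only [map_add, hx, hy]

/-- The contraaction `Hom_A(C, Hom^D(N, Q)) → Hom^D(N, Q)`, `h ↦ (n ↦ h(n₍₋₁₎)(n₍₀₎))`. -/
def homDAct (Q : Comod B D) : RHom A C (homD A C B D N Q) →ₗ[Aᵐᵒᵖ] homD A C B D N Q :=
  LinearMap.codRestrict _
    ((RHom.contract (rhoL A C B D N)).comp (RHom.postcomp (homD A C B D N Q).subtype))
    (fun h => contract_mem_homD A C B D N Q _ (fun c => (h c).2))

theorem homDAct_coe (Q : Comod B D) (h : RHom A C (homD A C B D N Q)) :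
    (homDAct A C B D N Q h : RHom B N Q.A) =
      RHom.contract (rhoL A C B D N) (RHom.postcomp (A := A) (homD A C B D N Q).subtype h) := rfl

theorem homDAct_assoc (Q : Comod B D) (k : RHom A C (RHom A C (homD A C B D N Q))) :
    homDAct A C B D N Q (RHom.contract Coring.comul k) =
      homDAct A C B D N Q (RHom.postcomp (A := A) (homDAct A C B D N Q) k) := by
  refine Subtype.ext ?_
  rw [homDAct_coe, homDAct_coe, ← RHom.contract_postcomp]
  exact RHom.contract_contract Coring.comul (rhoL A C B D N)
    (coassocL (A := A) (C := C) (B := B) (D := D))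
    (RHom.postcomp (A := A) (RHom.postcomp (A := A) (homD A C B D N Q).subtype) k)

/-- The `C`-contramodule `Hom^D(N, Q)`. -/
def homDContra (Q : Comod B D) : Contramod A C where
  A := ModuleCat.of Aᵐᵒᵖ (homD A C B D N Q)
  a := ModuleCat.ofHom (homDAct A C B D N Q)
  unit := by
    ext f n
    exact DFunLike.congr_fun (RHom.contract_const Coring.counit (rhoL A C B D N)
      (counitL (A := A) (C := C) (B := B) (D := D)) f.1) n
  assoc := by
    ext k n
    exact DFunLike.congr_fun (congrArg Subtype.val (homDAct_assoc A C B D N Q k)) n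

theorem postcomp_mem_homD {Q P : Comod B D} (g : Q ⟶ P) (f : RHom B N Q.A)
    (hf : f ∈ homD A C B D N Q) :
    RHom.postcomp (A := A) g.f.hom f ∈ homD A C B D N P := by
  intro n
  have hg : TensorOver.rmap B D g.f.hom (coact Q (f n)) = coact P (g.f.hom (f n)) :=
    congrArg (fun φ => φ.hom (f n)) g.h
  rw [RHom.postcomp_apply, ← hg, hf n]
  generalize rhoR A C B D N n = t
  induction t using TensorOver.induction_on with
  | h0 => simp only [map_zero]
  | ht m d => rfl
  | ha x y hx hy => simp only [map_add, hx, hy]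

/-- Composition with a comodule map `g : Q → P`, as a map `Hom^D(N, Q) → Hom^D(N, P)`. -/
def homDMap {Q P : Comod B D} (g : Q ⟶ P) : homD A C B D N Q →ₗ[Aᵐᵒᵖ] homD A C B D N P :=
  LinearMap.codRestrict (homD A C B D N P)
    ((RHom.postcomp g.f.hom).comp (homD A C B D N Q).subtype)
    (fun f => postcomp_mem_homD A C B D N g f.1 f.2)

/-- The functor `Hom^D(N, -) : M^D → M_{[C,-]}`. -/
def homDFunctor : Comod B D ⥤ Contramod A C where
  obj Q := homDContra A C B D N Q
  map {Q P} g :=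
    { f := ModuleCat.ofHom (homDMap A C B D N g)
      h := by
        ext h
        exact Subtype.ext (RHom.contract_postcomp g.f.hom (rhoL A C B D N)
          (RHom.postcomp (A := A) (homD A C B D N Q).subtype h)) }
  map_id _ := rfl
  map_comp _ _ := rfl

/-- The map `Hom_A(C, X) → Hom_B(N, X ⊗_A N)`, `f ↦ (f ⊗_A N) ∘ ρ`, with `ρ` the left coaction
of `N`. -/
def canAux (X : ModuleCat.{u} Aᵐᵒᵖ) : RHom A C X →ₗ[Aᵐᵒᵖ] RHom B N (TensorOver A X N) where
  toFun f := RHom.ofLin ((TensorOver.rmap B N f.lin).comp (rhoL A C B D N).right)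
  map_add' f g := RHom.ext fun n => by
    change TensorOver.rmap B N (f + g).lin (rhoL A C B D N n) =
      TensorOver.rmap B N f.lin (rhoL A C B D N n) + TensorOver.rmap B N g.lin (rhoL A C B D N n)
    generalize rhoL A C B D N n = t
    induction t using TensorOver.induction_on with
    | h0 => simp only [map_zero, add_zero]
    | ht c m => exact TensorOver.add_tmul (f c) (g c) m
    | ha x y hx hy => rw [map_add, map_add, map_add, hx, hy]; abel
  map_smul' a f := RHom.ext fun n => by
    change TensorOver.rmap B N (a • f).lin (rhoL A C B D N n) =
      TensorOver.rmap B N f.lin ((rhoL A C B D N) (a.unop • n))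
    rw [map_smul]
    generalize rhoL A C B D N n = t
    induction t using TensorOver.induction_on with
    | h0 => simp only [smul_zero, map_zero]
    | ht c m => rfl
    | ha x y hx hy => rw [map_add, smul_add, map_add, hx, hy]

theorem canAux_apply (X : ModuleCat.{u} Aᵐᵒᵖ) (f : RHom A C X) (n : N) :
    canAux A C B D N X f n = TensorOver.rmap B N f.lin (rhoL A C B D N n) := rfl

theorem coactOn_canAux (X : ModuleCat.{u} Aᵐᵒᵖ) (f : RHom A C X) (n : N) :
    coactOn X (rhoR A C B D N) (canAux A C B D N X f n) =
      TensorOver.map (canAux A C B D N X f).lin LinearMap.id (rhoR A C B D N n) := by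
  rw [canAux_apply, coactOn_naturality, coactOn_rhoL]
  generalize rhoR A C B D N n = t
  induction t using TensorOver.induction_on with
  | h0 => simp only [map_zero]
  | ht m d => rfl
  | ha x y hx hy => simp only [map_add, hx, hy]

theorem canAux_mem (X : ModuleCat.{u} Aᵐᵒᵖ) (f : RHom A C X) :
    canAux A C B D N X f ∈ homD A C B D N (tensorComod A C B D N X) :=
  coactOn_canAux A C B D N X f

/-- The component at `X` of the canonical monad morphism
`Hom_A(C, -) → Hom^D(N, - ⊗_A N)`, `f ↦ (f ⊗_A N) ∘ ρ`, with `ρ` the left coaction of `N`. -/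
def can (X : ModuleCat.{u} Aᵐᵒᵖ) :
    RHom A C X →ₗ[Aᵐᵒᵖ] homD A C B D N (tensorComod A C B D N X) :=
  LinearMap.codRestrict _ (canAux A C B D N X) (canAux_mem A C B D N X)

/-- `N` is a `[C, -]`-Galois bicomodule: the canonical monad morphism
`Hom_A(C, -) → Hom^D(N, - ⊗_A N)` is an isomorphism. -/
def IsContraGalois : Prop :=
  ∀ X : ModuleCat.{u} Aᵐᵒᵖ, Function.Bijective (can A C B D N X)

/-- The first of the two maps `Hom_A(C, M) ⊗_A N → M ⊗_A N` whose coequaliser is the contratensor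
product: `f ⊗ n ↦ (f ⊗_A N)(ρ(n))` with `ρ` the left coaction of `N`. -/
def contraDiff₀ (M : Contramod A C) :
    TensorOver A (RHom A C M.A) N →ₗ[Bᵐᵒᵖ] TensorOver A M.A N :=
  RHom.evLin (RHom.ofLin (canAux A C B D N M.A))

variable {A C} in
/-- The second of these maps, `α ⊗_A N` with `α` the contraaction of `M`. -/
def contraDiff₁ (M : Contramod A C) :
    TensorOver A (RHom A C M.A) N →ₗ[Bᵐᵒᵖ] TensorOver A M.A N :=
  TensorOver.rmap B N (contraact M)

/-- The contratensor product `M ⊗_{[C,-]} N` as a right `B`-module: the coequaliser of the two maps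
`Hom_A(C, M) ⊗_A N → M ⊗_A N`. -/
abbrev ContraTensor (M : Contramod A C) : Type u :=
  TensorOver A M.A N ⧸ LinearMap.range (contraDiff₀ A C B D N M - contraDiff₁ B N M)

theorem range_le_ker {M : Contramod A C} {Y : Type*} [AddCommGroup Y] [Module Bᵐᵒᵖ Y]
    (φ : TensorOver A M.A N →ₗ[Bᵐᵒᵖ] Y)
    (hφ : ∀ (f : RHom A C M.A) (n : N),
      φ (TensorOver.rmap B N f.lin (rhoL A C B D N n)) =
        φ (TensorOver.tmul A (contraact M f) n)) :
    LinearMap.range (contraDiff₀ A C B D N M - contraDiff₁ B N M) ≤ LinearMap.ker φ := by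
  rintro _ ⟨t, rfl⟩
  rw [LinearMap.mem_ker, LinearMap.sub_apply, map_sub, sub_eq_zero]
  induction t using TensorOver.induction_on with
  | h0 => simp only [map_zero]
  | ht f n => exact hφ f n
  | ha x y hx hy => simp only [map_add, hx, hy]

theorem mkQ_rel (M : Contramod A C) (f : RHom A C M.A) (n : N) :
    (LinearMap.range (contraDiff₀ A C B D N M - contraDiff₁ B N M)).mkQ
        (TensorOver.rmap B N f.lin (rhoL A C B D N n)) =
      (LinearMap.range (contraDiff₀ A C B D N M - contraDiff₁ B N M)).mkQ
        (TensorOver.tmul A (contraact M f) n) :=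
  (Submodule.Quotient.eq _).2 ⟨TensorOver.tmul A f n, rfl⟩

theorem contraTensorMap_rel {M M' : Contramod A C} (g : M ⟶ M') (f : RHom A C M.A) (n : N) :
    (LinearMap.range (contraDiff₀ A C B D N M' - contraDiff₁ B N M')).mkQ
        (TensorOver.rmap B N g.f.hom (TensorOver.rmap B N f.lin (rhoL A C B D N n))) =
      (LinearMap.range (contraDiff₀ A C B D N M' - contraDiff₁ B N M')).mkQ
        (TensorOver.tmul A (g.f.hom (contraact M f)) n) := by
  have hg : contraact M' (RHom.postcomp (A := A) g.f.hom f) = g.f.hom (contraact M f) :=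
    congrArg (fun φ => φ.hom f) g.h
  have h1 (t : TensorOver A C N) : TensorOver.rmap B N g.f.hom (TensorOver.rmap B N f.lin t) =
      TensorOver.rmap B N (RHom.postcomp (A := A) g.f.hom f).lin t := by
    induction t using TensorOver.induction_on with
    | h0 => simp only [map_zero]
    | ht m d => rfl
    | ha x y hx hy => simp only [map_add, hx, hy]
  rw [h1, ← hg]
  exact mkQ_rel A C B D N M' (RHom.postcomp (A := A) g.f.hom f) n

/-- The map `g ⊗_{[C,-]} N` for a map `g : M → M'` of contramodules. -/
def contraTensorMap {M M' : Contramod A C} (g : M ⟶ M') :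
    ContraTensor A C B D N M →ₗ[Bᵐᵒᵖ] ContraTensor A C B D N M' :=
  Submodule.liftQ _
    ((Submodule.mkQ _).comp (TensorOver.rmap B N g.f.hom))
    (range_le_ker A C B D N _ (contraTensorMap_rel A C B D N g))

theorem contraTensorMap_id (M : Contramod A C) :
    contraTensorMap A C B D N (𝟙 M) = LinearMap.id :=
  Submodule.linearMap_qext _ (LinearMap.ext fun s =>
    congrArg (Submodule.mkQ _) (DFunLike.congr_fun TensorOver.map_id s))

theorem rmap_comp {X Y Z : Type*} [AddCommGroup X] [Module Aᵐᵒᵖ X] [AddCommGroup Y]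
    [Module Aᵐᵒᵖ Y] [AddCommGroup Z] [Module Aᵐᵒᵖ Z] (g : X →ₗ[Aᵐᵒᵖ] Y) (g' : Y →ₗ[Aᵐᵒᵖ] Z)
    (s : TensorOver A X N) :
    TensorOver.rmap B N (g'.comp g) s = TensorOver.rmap B N g' (TensorOver.rmap B N g s) := by
  induction s using TensorOver.induction_on with
  | h0 => simp only [map_zero]
  | ht m d => rfl
  | ha x y hx hy => simp only [map_add, hx, hy]

theorem contraTensorMap_comp {M M' M'' : Contramod A C} (g : M ⟶ M') (g' : M' ⟶ M'') :
    contraTensorMap A C B D N (g ≫ g') =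
      (contraTensorMap A C B D N g').comp (contraTensorMap A C B D N g) :=
  Submodule.linearMap_qext _ (LinearMap.ext fun s =>
    congrArg (Submodule.mkQ _) (rmap_comp A B N g.f.hom g'.f.hom s))

/-- The functor `- ⊗_{[C,-]} N : M_{[C,-]} → M_B`. -/
def contraTensorFunctor : Contramod A C ⥤ ModuleCat.{u} Bᵐᵒᵖ where
  obj M := ModuleCat.of Bᵐᵒᵖ (ContraTensor A C B D N M)
  map g := ModuleCat.ofHom (contraTensorMap A C B D N g)
  map_id M := ModuleCat.hom_ext (contraTensorMap_id A C B D N M)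
  map_comp g g' := ModuleCat.hom_ext (contraTensorMap_comp A C B D N g g')

/-- The map `Hom_B(N, X) → Hom_B(N, X ⊗_B D)`, `f ↦ (f ⊗_B D) ∘ ρ^N`. -/
def comodCanAux (X : ModuleCat.{u} Bᵐᵒᵖ) :
    RHom B N X →ₗ[Aᵐᵒᵖ] RHom B N (TensorOver B X D) where
  toFun f := RHom.ofLin ((TensorOver.rmap B D f.lin).comp (rhoR A C B D N).right)
  map_add' f g := RHom.ext fun n => by
    change TensorOver.rmap B D (f + g).lin (rhoR A C B D N n) =
      TensorOver.rmap B D f.lin (rhoR A C B D N n) + TensorOver.rmap B D g.lin (rhoR A C B D N n)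
    generalize rhoR A C B D N n = t
    induction t using TensorOver.induction_on with
    | h0 => simp only [map_zero, add_zero]
    | ht m d => exact TensorOver.add_tmul (f m) (g m) d
    | ha x y hx hy => rw [map_add, map_add, map_add, hx, hy]; abel
  map_smul' a f := RHom.ext fun n => by
    change TensorOver.rmap B D (a • f).lin (rhoR A C B D N n) =
      TensorOver.rmap B D f.lin ((rhoR A C B D N) (a.unop • n))
    rw [map_smul]
    generalize rhoR A C B D N n = t
    induction t using TensorOver.induction_on with
    | h0 => simp only [smul_zero, map_zero]
    | ht m d => rfl
    | ha x y hx hy => rw [map_add, smul_add, map_add, hx, hy]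

theorem comodCan_rel (X : ModuleCat.{u} Bᵐᵒᵖ) (f : RHom A C (RHom B N X)) (n : N) :
    RHom.evLin (A := A) (RHom.ofLin (comodCanAux A C B D N X))
        (TensorOver.rmap B N f.lin (rhoL A C B D N n)) =
      TensorOver.rmap B D (RHom.contract (rhoL A C B D N) f).lin (rhoR A C B D N n) := by
  have h1 (t : TensorOver A C N) :
      RHom.evLin (A := A) (RHom.ofLin (comodCanAux A C B D N X)) (TensorOver.rmap B N f.lin t) =
        TensorOver.map (RHom.ev f).lin LinearMap.id (coactOn C (rhoR A C B D N) t) := by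
    induction t using TensorOver.induction_on with
    | h0 => simp only [map_zero]
    | ht c n =>
      rw [coactOn_tmul]
      change TensorOver.rmap B D (f c).lin (rhoR A C B D N n) = _
      generalize rhoR A C B D N n = s
      induction s using TensorOver.induction_on with
      | h0 => simp only [TensorOver.tmul_zero, map_zero]
      | ht n d => rfl
      | ha x y hx hy => simp only [TensorOver.tmul_add, map_add, hx, hy]
    | ha x y hx hy => simp only [map_add, hx, hy]
  rw [h1, coactOn_rhoL]
  generalize rhoR A C B D N n = s
  induction s using TensorOver.induction_on with
  | h0 => simp only [map_zero]
  | ht n d => rfl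
  | ha x y hx hy => simp only [map_add, hx, hy]

/-- The component at `X` of the canonical comonad morphism
`Hom_B(N, -) ⊗_{[C,-]} N → - ⊗_B D`, `f ⊗ n ↦ (f ⊗_B D)(ρ^N(n))`. -/
def comodCan (X : ModuleCat.{u} Bᵐᵒᵖ) :
    ContraTensor A C B D N (homContra A C B D N X) →ₗ[Bᵐᵒᵖ] TensorOver B X D :=
  Submodule.liftQ _
    (RHom.evLin (A := A) (RHom.ofLin (comodCanAux A C B D N X)))
    (range_le_ker A C B D N (M := homContra A C B D N X) _ (comodCan_rel A C B D N X))

/-- `N` is a `D`-Galois bicomodule: the canonical comonad morphism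
`Hom_B(N, -) ⊗_{[C,-]} N → - ⊗_B D` is an isomorphism. -/
def IsComodGalois : Prop :=
  ∀ X : ModuleCat.{u} Bᵐᵒᵖ, Function.Bijective (comodCan A C B D N X)

end Bicomodule

end Bicomodules

end

/-! Write L for the contratensor functor with values in `D`-comodules, R for Hom^D(N, -), and U for
a forgetful functor to modules. Then L is left adjoint to R (`contraAdj`), and the functor of
condition (c) is U L.

Both Galois conditions are statements about this adjunction. On a free contramodule, L([C, X]) is X
⊗_A N, so `can` is the unit at [C, X] up to an isomorphism (`isContraGalois_iff`). On a cofree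
comodule, R(X ⊗_B D) is Hom_B(N, X), so `comodCan` is the counit at X ⊗_B D up to an isomorphism
(`isComodGalois_iff`). Every contramodule is a coequalizer of free ones and every comodule is an
equalizer of cofree ones. The unit or counit is therefore invertible everywhere once the functors
involved preserve these (co)limits (`Monad.isIso_app_of_free`, `Comonad.isIso_app_of_cofree`).
Projectivity of `C` makes U exact on contramodules, and flatness of `D` makes U exact on comodules.
Both categories are then balanced, so faithful functors out of them reflect isomorphisms.

From (b): lifting can(id_C) along F ⊗_A N → C ⊗_A N, for F free over C, shows that `C` is
projective. Since `D` is flat and `N` projective, U R preserves coequalizers, so the unit is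
invertible. A triangle identity then makes R(counit) invertible, and R is faithful because `N` is a
generator.

From (c): naturality of `comodCan` transports left exactness of U L to - ⊗_B D, so `D` is flat. Then
U L R and U preserve equalizers, so the counit is invertible. The other triangle identity makes
L(unit) invertible, and U L is faithful.

From (a): unit and counit are invertible, and the remaining properties pass through the equivalence,
using exactness of the forgetful functors. -/

noncomputable section

namespace Bicomodule

variable (A C B D N : Type u) [Ring A] [AddCommGroup C] [Module A C] [Module Aᵐᵒᵖ C]
    [SMulCommClass A Aᵐᵒᵖ C] [Coring A C] [Ring B] [AddCommGroup D] [Module B D] [Module Bᵐᵒᵖ D]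
    [SMulCommClass B Bᵐᵒᵖ D] [Coring B D] [AddCommGroup N] [Module A N] [Module Bᵐᵒᵖ N]
    [SMulCommClass A Bᵐᵒᵖ N] [Bicomodule A C B D N]

/-! ## The adjunction between comodules and contramodules -/

/-- The quotient map `M ⊗_A N → M ⊗_{[C,-]} N`. -/
abbrev contraMk (M : Contramod A C) : TensorOver A M.A N →ₗ[Bᵐᵒᵖ] ContraTensor A C B D N M :=
  Submodule.mkQ _

theorem contraTensor_induction {M : Contramod A C} {p : ContraTensor A C B D N M → Prop}
    (x : ContraTensor A C B D N M) (h0 : p 0)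
    (ht : ∀ m n, p (contraMk A C B D N M (TensorOver.tmul A m n)))
    (ha : ∀ x y, p x → p y → p (x + y)) : p x := by
  obtain ⟨t, rfl⟩ := Submodule.mkQ_surjective _ x
  induction t using TensorOver.induction_on with
  | h0 => simpa only [map_zero] using h0
  | ht m n => exact ht m n
  | ha x y hx hy => simpa only [map_add] using ha _ _ hx hy

theorem contraTensor_hom_ext {M : Contramod A C} {Y : Type*} [AddCommGroup Y] [Module Bᵐᵒᵖ Y]
    {φ ψ : ContraTensor A C B D N M →ₗ[Bᵐᵒᵖ] Y}
    (h : ∀ m n, φ (contraMk A C B D N M (TensorOver.tmul A m n)) =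
      ψ (contraMk A C B D N M (TensorOver.tmul A m n))) : φ = ψ := by
  refine LinearMap.ext fun x => ?_
  induction x using contraTensor_induction with
  | h0 => simp only [map_zero]
  | ht m n => exact h m n
  | ha x y hx hy => simp only [map_add, hx, hy]

/-- The map `N → M ⊗_A N`, `n ↦ m ⊗ n`, of right `B`-modules. -/
def tmulLin {M : Type*} [AddCommGroup M] [Module Aᵐᵒᵖ M] (m : M) :
    N →ₗ[Bᵐᵒᵖ] TensorOver A M N where
  toFun := TensorOver.tmul A m
  map_add' := TensorOver.tmul_add m
  map_smul' _ _ := rfl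

/-- The left coaction of `N` is `D`-colinear (`coactOn_rhoL`), so the coaction of M ⊗_A N sends
contratensor relations to contratensor relations and descends to the quotient. -/
theorem coact_rel (M : Contramod A C) (f : RHom A C M.A) (n : N) :
    TensorOver.rmap B D (contraMk A C B D N M)
        (coactOn M.A (rhoR A C B D N) (TensorOver.rmap B N f.lin (rhoL A C B D N n))) =
      TensorOver.rmap B D (contraMk A C B D N M)
        (coactOn M.A (rhoR A C B D N) (TensorOver.tmul A (contraact M f) n)) := by
  rw [coactOn_naturality, coactOn_rhoL, coactOn_tmul]
  generalize rhoR A C B D N n = s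
  induction s using TensorOver.induction_on with
  | h0 => simp only [map_zero, TensorOver.tmul_zero]
  | ht n d => exact congrArg (TensorOver.tmul B · d) (mkQ_rel A C B D N M f n)
  | ha x y hx hy => simp only [map_add, hx, hy, TensorOver.tmul_add]

/-- The right `D`-coaction on `M ⊗_{[C,-]} N`. -/
def contraTensorCoact (M : Contramod A C) :
    ContraTensor A C B D N M →ₗ[Bᵐᵒᵖ] TensorOver B (ContraTensor A C B D N M) D :=
  Submodule.liftQ _
    ((TensorOver.rmap B D (contraMk A C B D N M)).comp (coactOn M.A (rhoR A C B D N)))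
    (range_le_ker A C B D N _ (coact_rel A C B D N M))

theorem contraTensorCoact_mk (M : Contramod A C) (t : TensorOver A M.A N) :
    contraTensorCoact A C B D N M (contraMk A C B D N M t) =
      TensorOver.rmap B D (contraMk A C B D N M) (coactOn M.A (rhoR A C B D N) t) := rfl

/-- The contratensor product `M ⊗_{[C,-]} N` as a right `D`-comodule. -/
def contraTensorComod (M : Contramod A C) : Comod B D where
  A := ModuleCat.of Bᵐᵒᵖ (ContraTensor A C B D N M)
  a := ModuleCat.ofHom (contraTensorCoact A C B D N M)
  counit := by
    refine ModuleCat.hom_ext (Submodule.linearMap_qext _ (LinearMap.ext fun t => ?_))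
    -- Naturality of the counit along the quotient map reduces the axiom to the comodule M ⊗_A N;
    -- coassociativity is reduced in the same way.
    have h := congrArg (fun φ => φ.hom (coactOn M.A (rhoR A C B D N) t))
      ((tensorComonad B D).ε.naturality (ModuleCat.ofHom (contraMk A C B D N M)))
    refine h.trans (congrArg (contraMk A C B D N M) ?_)
    exact coactOn_counit M.A Coring.counit (rhoR A C B D N)
      (counitR (A := A) (C := C) (B := B) (D := D)) t
  coassoc := by
    refine ModuleCat.hom_ext (Submodule.linearMap_qext _ (LinearMap.ext fun t => ?_))
    have h := congrArg (fun φ => φ.hom (coactOn M.A (rhoR A C B D N) t))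
      (((tensorComonad B D).δ.naturality (ModuleCat.ofHom (contraMk A C B D N M))))
    refine h.trans ?_
    refine (congrArg (TensorOver.rmap B D (TensorOver.rmap B D (contraMk A C B D N M)))
      (coactOn_coassoc M.A Coring.comul (rhoR A C B D N)
        (coassocR (A := A) (C := C) (B := B) (D := D)) t)).trans ?_
    change _ = TensorOver.rmap B D (contraTensorCoact A C B D N M)
      (TensorOver.rmap B D (contraMk A C B D N M) (coactOn M.A (rhoR A C B D N) t))
    generalize coactOn M.A (rhoR A C B D N) t = s
    induction s using TensorOver.induction_on with
    | h0 => simp only [map_zero]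
    | ht x d => rfl
    | ha x y hx hy => simp only [map_add, hx, hy]

/-- The functor `- ⊗_{[C,-]} N : M_{[C,-]} → M^D`. -/
def contraTensorComodFunctor : Contramod A C ⥤ Comod B D where
  obj M := contraTensorComod A C B D N M
  map {M M'} g :=
    { f := ModuleCat.ofHom (contraTensorMap A C B D N g)
      h := by
        refine ModuleCat.hom_ext (Submodule.linearMap_qext _ (LinearMap.ext fun t => ?_))
        change TensorOver.rmap B D (contraTensorMap A C B D N g)
            (TensorOver.rmap B D (contraMk A C B D N M) (coactOn M.A (rhoR A C B D N) t)) =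
          TensorOver.rmap B D (contraMk A C B D N M')
            (coactOn M'.A (rhoR A C B D N) (TensorOver.rmap B N g.f.hom t))
        rw [coactOn_naturality]
        generalize coactOn M.A (rhoR A C B D N) t = s
        induction s using TensorOver.induction_on with
        | h0 => simp only [map_zero]
        | ht x d => rfl
        | ha x y hx hy => simp only [map_add, hx, hy] }
  map_id M := Comonad.Coalgebra.Hom.ext (ModuleCat.hom_ext (contraTensorMap_id A C B D N M))
  map_comp g g' :=
    Comonad.Coalgebra.Hom.ext (ModuleCat.hom_ext (contraTensorMap_comp A C B D N g g'))

/-- Links condition (c), which concerns the module-valued functor, to the comodule-valued left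
adjoint. -/
theorem contraTensorComodFunctor_comp_forget :
    contraTensorComodFunctor A C B D N ⋙ (tensorComonad B D).forget =
      contraTensorFunctor A C B D N := rfl

/-- The map `M → Hom_B(N, M ⊗_{[C,-]} N)`, `m ↦ (n ↦ m ⊗ n)`. -/
def contraUnitAux (M : Contramod A C) : M.A →ₗ[Aᵐᵒᵖ] RHom B N (ContraTensor A C B D N M) where
  toFun m := RHom.ofLin ((contraMk A C B D N M).comp (tmulLin A B N m))
  map_add' m m' := RHom.ext fun n => by
    change contraMk A C B D N M (TensorOver.tmul A (m + m') n) = _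
    rw [TensorOver.add_tmul, map_add]
    rfl
  map_smul' a m := RHom.ext fun n =>
    congrArg (contraMk A C B D N M) (TensorOver.smul_tmul m a.unop n)

theorem contraUnitAux_mem (M : Contramod A C) (m : M.A) :
    contraUnitAux A C B D N M m ∈ homD A C B D N (contraTensorComod A C B D N M) := by
  intro n
  change TensorOver.rmap B D (contraMk A C B D N M)
    (coactOn M.A (rhoR A C B D N) (TensorOver.tmul A m n)) =
      TensorOver.rmap B D (contraUnitAux A C B D N M m).lin (rhoR A C B D N n)
  rw [coactOn_tmul]
  generalize rhoR A C B D N n = s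
  induction s using TensorOver.induction_on with
  | h0 => simp only [map_zero, TensorOver.tmul_zero]
  | ht n d => rfl
  | ha x y hx hy => simp only [map_add, hx, hy, TensorOver.tmul_add]

/-- The map of contramodules `M → Hom^D(N, M ⊗_{[C,-]} N)`, `m ↦ (n ↦ m ⊗ n)`. -/
def contraUnit (M : Contramod A C) : M ⟶ homDContra A C B D N (contraTensorComod A C B D N M) where
  f := ModuleCat.ofHom (LinearMap.codRestrict _ (contraUnitAux A C B D N M)
    (contraUnitAux_mem A C B D N M))
  h := by
    refine ModuleCat.hom_ext (LinearMap.ext fun f => Subtype.ext (RHom.ext fun n => ?_))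
    -- The defining relations of the contratensor product are exactly the compatibility of the unit
    -- with contraactions.
    refine Eq.trans ?_ (mkQ_rel A C B D N M f n)
    change RHom.evLin (A := A) (RHom.ofLin ((contraUnitAux A C B D N M).comp f.lin))
      (rhoL A C B D N n) = contraMk A C B D N M (TensorOver.rmap B N f.lin (rhoL A C B D N n))
    generalize rhoL A C B D N n = s
    induction s using TensorOver.induction_on with
    | h0 => simp only [map_zero]
    | ht c n => rfl
    | ha x y hx hy => simp only [map_add, hx, hy]

theorem contraCounit_rel (Q : Comod B D) (h : RHom A C (homD A C B D N Q)) (n : N) :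
    RHom.evLin (A := A) (RHom.ofLin (homD A C B D N Q).subtype)
        (TensorOver.rmap B N h.lin (rhoL A C B D N n)) =
      RHom.evLin (A := A) (RHom.ofLin (homD A C B D N Q).subtype)
        (TensorOver.tmul A (homDAct A C B D N Q h) n) := by
  change _ = RHom.ev (RHom.postcomp (A := A) (homD A C B D N Q).subtype h) (rhoL A C B D N n)
  generalize rhoL A C B D N n = s
  induction s using TensorOver.induction_on with
  | h0 => simp only [map_zero]
  | ht c n => rfl
  | ha x y hx hy => simp only [map_add, hx, hy]

/-- The map `Hom^D(N, Q) ⊗_{[C,-]} N → Q`, `f ⊗ n ↦ f(n)`. -/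
def contraCounitLin (Q : Comod B D) :
    ContraTensor A C B D N (homDContra A C B D N Q) →ₗ[Bᵐᵒᵖ] Q.A :=
  Submodule.liftQ _
    (RHom.evLin (A := A) (RHom.ofLin (homD A C B D N Q).subtype))
    (range_le_ker A C B D N (M := homDContra A C B D N Q) _ (contraCounit_rel A C B D N Q))

/-- The map of comodules `Hom^D(N, Q) ⊗_{[C,-]} N → Q`, `f ⊗ n ↦ f(n)`. -/
def contraCounit (Q : Comod B D) :
    contraTensorComod A C B D N (homDContra A C B D N Q) ⟶ Q where
  f := ModuleCat.ofHom (contraCounitLin A C B D N Q)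
  h := by
    refine ModuleCat.hom_ext (LinearMap.ext fun x => ?_)
    change TensorOver.rmap B D (contraCounitLin A C B D N Q) (contraTensorCoact A C B D N _ x) =
      coact Q (contraCounitLin A C B D N Q x)
    induction x using contraTensor_induction with
    | h0 => simp only [map_zero]
    | ht f n =>
      rw [contraTensorCoact_mk, coactOn_tmul]
      -- Evaluation is colinear because each `f` in Hom^D(N, Q) is.
      refine Eq.trans ?_ (f.2 n).symm
      generalize rhoR A C B D N n = s
      induction s using TensorOver.induction_on with
      | h0 => simp only [map_zero, TensorOver.tmul_zero]
      | ht n d => rfl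
      | ha x y hx hy => simp only [map_add, hx, hy, TensorOver.tmul_add]
    | ha x y hx hy => simp only [map_add, hx, hy]

/-- The adjunction `- ⊗_{[C,-]} N ⊣ Hom^D(N, -)`. -/
def contraAdj : contraTensorComodFunctor A C B D N ⊣ homDFunctor A C B D N :=
  Adjunction.mkOfUnitCounit
    { unit :=
        { app := contraUnit A C B D N
          naturality := fun M M' g => rfl }
      counit :=
        { app := contraCounit A C B D N
          naturality := fun Q P g => by
            refine Comonad.Coalgebra.Hom.ext (ModuleCat.hom_ext
              (contraTensor_hom_ext A C B D N fun _ _ => rfl)) }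
      left_triangle := by
        ext M : 2
        refine Comonad.Coalgebra.Hom.ext (ModuleCat.hom_ext
          (contraTensor_hom_ext A C B D N fun _ _ => rfl))
      right_triangle := rfl }

/-! ## Free contramodules and cofree comodules -/

/-- This is coassociativity of the left coaction of `N`, evaluated against `k`. It makes
`freeTensorLin` well defined. -/
theorem can_rel (X : ModuleCat.{u} Aᵐᵒᵖ) (k : RHom A C (RHom A C X)) (n : N) :
    RHom.evLin (A := A) (RHom.ofLin (canAux A C B D N X))
        (TensorOver.rmap B N k.lin (rhoL A C B D N n)) =
      TensorOver.rmap B N (RHom.contract Coring.comul k).lin (rhoL A C B D N n) := by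
  have h1 (t : TensorOver A C N) :
      RHom.evLin (A := A) (RHom.ofLin (canAux A C B D N X)) (TensorOver.rmap B N k.lin t) =
        TensorOver.rmap B N (RHom.ev k).lin (TensorOver.assocInv A A C C N
          (TensorOver.map LinearMap.id (rhoL A C B D N).left t)) := by
    induction t using TensorOver.induction_on with
    | h0 => simp only [map_zero]
    | ht c n =>
      change TensorOver.rmap B N (k c).lin (rhoL A C B D N n) =
        TensorOver.rmap B N (RHom.ev k).lin (TensorOver.assocInv A A C C N
          (TensorOver.tmul A c (rhoL A C B D N n)))
      generalize rhoL A C B D N n = s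
      induction s using TensorOver.induction_on with
      | h0 => simp only [TensorOver.tmul_zero, map_zero]
      | ht n d => rfl
      | ha x y hx hy => simp only [TensorOver.tmul_add, map_add, hx, hy]
    | ha x y hx hy => simp only [map_add, hx, hy]
  have h2 : TensorOver.map LinearMap.id (rhoL A C B D N).left (rhoL A C B D N n) =
      TensorOver.assoc A A C C N
        (TensorOver.map (Coring.comul (A := A) (C := C)).right LinearMap.id (rhoL A C B D N n)) :=
    (coassocL (A := A) (C := C) (B := B) (D := D) n).symm
  rw [h1, h2, TensorOver.assocInv_assoc]
  generalize rhoL A C B D N n = s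
  induction s using TensorOver.induction_on with
  | h0 => simp only [map_zero]
  | ht n d => rfl
  | ha x y hx hy => simp only [map_add, hx, hy]

/-- The map `[C, X] ⊗_{[C,-]} N → X ⊗_A N`, `f ⊗ n ↦ (f ⊗_A N)(ρ(n))`. -/
def freeTensorLin (X : ModuleCat.{u} Aᵐᵒᵖ) :
    ContraTensor A C B D N ((contraMonad A C).free.obj X) →ₗ[Bᵐᵒᵖ] TensorOver A X N :=
  Submodule.liftQ _
    (RHom.evLin (A := A) (RHom.ofLin (canAux A C B D N X)))
    (range_le_ker A C B D N (M := (contraMonad A C).free.obj X) _ (can_rel A C B D N X))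

/-- The inverse `X ⊗_A N → [C, X] ⊗_{[C,-]} N` of `freeTensorLin`. -/
def freeTensorInv (X : ModuleCat.{u} Aᵐᵒᵖ) :
    TensorOver A X N →ₗ[Bᵐᵒᵖ] ContraTensor A C B D N ((contraMonad A C).free.obj X) :=
  (contraMk A C B D N ((contraMonad A C).free.obj X)).comp
    (TensorOver.rmap B N (RHom.const (A := A) (C := C) (X := X) Coring.counit))

theorem freeTensorLin_inv (X : ModuleCat.{u} Aᵐᵒᵖ) (t : TensorOver A X N) :
    freeTensorLin A C B D N X (freeTensorInv A C B D N X t) = t := by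
  induction t using TensorOver.induction_on with
  | h0 => simp only [map_zero]
  | ht x n =>
    change TensorOver.rmap B N (RHom.const (A := A) (C := C) (X := X) Coring.counit x).lin
      (rhoL A C B D N n) = _
    have h (s : TensorOver A C N) :
        TensorOver.rmap B N (RHom.const (A := A) (C := C) (X := X) Coring.counit x).lin s =
          TensorOver.tmul A x (TensorOver.lid A N
            (TensorOver.map (Coring.counit (A := A) (C := C)).right LinearMap.id s)) := by
      induction s using TensorOver.induction_on with
      | h0 => simp only [map_zero, TensorOver.tmul_zero]
      | ht c n => exact TensorOver.smul_tmul x _ n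
      | ha x y hx hy => simp only [map_add, hx, hy, TensorOver.tmul_add]
    rw [h]
    exact congrArg _ (counitL (A := A) (C := C) (B := B) (D := D) n)
  | ha x y hx hy => simp only [map_add, hx, hy]

/-- Apply the contratensor relation to k = η ∘ f, with η the unit of the monad. The right unit law
contracts `k` to `f`, so one side is f ⊗ n; the other is the round trip of f ⊗ n. -/
theorem freeTensorInv_lin (X : ModuleCat.{u} Aᵐᵒᵖ)
    (x : ContraTensor A C B D N ((contraMonad A C).free.obj X)) :
    freeTensorInv A C B D N X (freeTensorLin A C B D N X x) = x := by
  suffices h : (freeTensorInv A C B D N X).comp (freeTensorLin A C B D N X) = LinearMap.id from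
    DFunLike.congr_fun h x
  refine contraTensor_hom_ext A C B D N fun f n => ?_
  let k : RHom A C (RHom A C X) :=
    RHom.postcomp (A := A) (RHom.const (A := A) (C := C) (X := X) Coring.counit) f
  have hk : RHom.contract Coring.comul k = f :=
    congrArg (fun φ => φ.hom f) ((contraMonad A C).right_unit X)
  have h := mkQ_rel A C B D N ((contraMonad A C).free.obj X) k n
  refine Eq.trans (congrArg (contraMk A C B D N ((contraMonad A C).free.obj X)) ?_)
    (h.trans (congrArg (fun g : RHom A C X => contraMk A C B D N ((contraMonad A C).free.obj X)
      (TensorOver.tmul A g n)) hk))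
  exact (rmap_comp A B N f.lin (RHom.const (A := A) (C := C) (X := X) Coring.counit)
    (rhoL A C B D N n)).symm

theorem freeTensorLin_bijective (X : ModuleCat.{u} Aᵐᵒᵖ) :
    Function.Bijective (freeTensorLin A C B D N X) :=
  Function.bijective_iff_has_inverse.2 ⟨freeTensorInv A C B D N X,
    freeTensorInv_lin A C B D N X, freeTensorLin_inv A C B D N X⟩

theorem freeTensorLin_coact (X : ModuleCat.{u} Aᵐᵒᵖ) (f : ((contraMonad A C).free.obj X).A)
    (n : N) :
    TensorOver.rmap B D (freeTensorLin A C B D N X)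
        (TensorOver.rmap B D (contraMk A C B D N ((contraMonad A C).free.obj X))
          (coactOn ((contraMonad A C).free.obj X).A (rhoR A C B D N) (TensorOver.tmul A f n))) =
      TensorOver.rmap B D ((freeTensorLin A C B D N X).comp
        ((contraMk A C B D N ((contraMonad A C).free.obj X)).comp (tmulLin A B N f)))
          (rhoR A C B D N n) := by
  rw [coactOn_tmul]
  generalize rhoR A C B D N n = s
  induction s using TensorOver.induction_on with
  | h0 => simp only [map_zero, TensorOver.tmul_zero]
  | ht n d => rfl
  | ha x y hx hy => simp only [map_add, hx, hy, TensorOver.tmul_add]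

/-- The map of comodules `[C, X] ⊗_{[C,-]} N → X ⊗_A N`. -/
def freeTensorHom (X : ModuleCat.{u} Aᵐᵒᵖ) :
    contraTensorComod A C B D N ((contraMonad A C).free.obj X) ⟶ tensorComod A C B D N X where
  f := ModuleCat.ofHom (freeTensorLin A C B D N X)
  h := ModuleCat.hom_ext (contraTensor_hom_ext A C B D N fun f n =>
    (freeTensorLin_coact A C B D N X f n).trans (coactOn_canAux A C B D N X f n).symm)

/-- Colinearity is inherited from the coassociativity of ρ^N. -/
theorem comodCanAux_mem (X : ModuleCat.{u} Bᵐᵒᵖ) (f : RHom B N X) :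
    comodCanAux A C B D N X f ∈ homD A C B D N ((tensorComonad B D).cofree.obj X) := by
  intro n
  change coactOn X (Coring.comul (A := B) (C := D))
    (TensorOver.rmap B D f.lin (rhoR A C B D N n)) =
      TensorOver.rmap B D (comodCanAux A C B D N X f).lin (rhoR A C B D N n)
  have h : coactOn N (Coring.comul (A := B) (C := D)) (rhoR A C B D N n) =
      TensorOver.map (rhoR A C B D N).right LinearMap.id (rhoR A C B D N n) :=
    (congrArg (TensorOver.assocInv B B N D D)
      (coassocR (A := A) (C := C) (B := B) (D := D) n).symm).trans
      (TensorOver.assocInv_assoc B B N D D _)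
  rw [coactOn_naturality, h]
  generalize rhoR A C B D N n = s
  induction s using TensorOver.induction_on with
  | h0 => simp only [map_zero]
  | ht n d => rfl
  | ha x y hx hy => simp only [map_add, hx, hy]

/-- The map of contramodules `Hom_B(N, X) → Hom^D(N, X ⊗_B D)`, `f ↦ (f ⊗_B D) ∘ ρ^N`. -/
def cofreeHom (X : ModuleCat.{u} Bᵐᵒᵖ) :
    homContra A C B D N X ⟶ homDContra A C B D N ((tensorComonad B D).cofree.obj X) where
  f := ModuleCat.ofHom (LinearMap.codRestrict _ (comodCanAux A C B D N X)
    (comodCanAux_mem A C B D N X))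
  h := by
    refine ModuleCat.hom_ext (LinearMap.ext fun f => Subtype.ext (RHom.ext fun n => ?_))
    -- Compatibility with contraactions is the identity that makes `comodCan` well defined.
    refine Eq.trans ?_ (comodCan_rel A C B D N X f n)
    change RHom.evLin (A := A) (RHom.ofLin ((comodCanAux A C B D N X).comp f.lin))
      (rhoL A C B D N n) = _
    generalize rhoL A C B D N n = s
    induction s using TensorOver.induction_on with
    | h0 => simp only [map_zero]
    | ht c n => rfl
    | ha x y hx hy => simp only [map_add, hx, hy]

/-- The usual adjunction between forgetful and cofree functors: the inverse composes with X ⊗_B ε.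
One round trip uses the counit law of `N`; the other uses colinearity of the given map and the
counit law of `D`. -/
theorem cofreeHom_bijective (X : ModuleCat.{u} Bᵐᵒᵖ) :
    Function.Bijective (cofreeHom A C B D N X).f.hom := by
  constructor
  · intro f g hfg
    have h (f : RHom B N X) (s : TensorOver B N D) :
        counitOn X (Coring.counit (A := B) (C := D)) (TensorOver.rmap B D f.lin s) =
          f (TensorOver.rid B N
            (TensorOver.map LinearMap.id (Coring.counit (A := B) (C := D)).left s)) := by
      induction s using TensorOver.induction_on with
      | h0 => simp only [map_zero]
      | ht n d => exact (map_smul f.lin _ n).symm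
      | ha x y hx hy => simp only [map_add, hx, hy]
    have h' (f : RHom B N X) (n : N) : counitOn X (Coring.counit (A := B) (C := D))
        (comodCanAux A C B D N X f n) = f n :=
      (h f _).trans (congrArg f (counitR (A := A) (C := C) (B := B) (D := D) n))
    have hfg' : comodCanAux A C B D N X f = comodCanAux A C B D N X g := congrArg Subtype.val hfg
    exact RHom.ext fun n => by rw [← h' f, hfg', h' g]
  · intro g
    refine ⟨RHom.ofLin ((counitOn X (Coring.counit (A := B) (C := D))).comp g.1.lin),
      Subtype.ext (RHom.ext fun n => ?_)⟩
    have h1 : TensorOver.rmap B D (counitOn X (Coring.counit (A := B) (C := D)))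
        (coactOn X (Coring.comul (A := B) (C := D)) (g.1 n)) = g.1 n :=
      congrArg (fun φ => φ.hom (g.1 n)) ((tensorComonad B D).right_counit X)
    have h2 : coactOn X (Coring.comul (A := B) (C := D)) (g.1 n) =
      TensorOver.rmap B D g.1.lin (rhoR A C B D N n) := g.2 n
    rw [h2] at h1
    exact (rmap_comp B B D g.1.lin _ _).trans h1

/-! ## Isomorphisms of modules, comodules and contramodules -/

theorem contramod_isIso_iff {M M' : Contramod A C} (g : M ⟶ M') :
    IsIso g ↔ Function.Bijective g.f.hom :=
  (isIso_iff_of_reflects_iso g (contraMonad A C).forget).symm.trans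
    (ConcreteCategory.isIso_iff_bijective g.f)

theorem comod_isIso_iff {Q P : Comod B D} (g : Q ⟶ P) :
    IsIso g ↔ Function.Bijective g.f.hom :=
  (isIso_iff_of_reflects_iso g (tensorComonad B D).forget).symm.trans
    (ConcreteCategory.isIso_iff_bijective g.f)

instance (X : ModuleCat.{u} Aᵐᵒᵖ) : IsIso (freeTensorHom A C B D N X) :=
  (comod_isIso_iff B D _).2 (freeTensorLin_bijective A C B D N X)

instance (X : ModuleCat.{u} Bᵐᵒᵖ) : IsIso (cofreeHom A C B D N X) :=
  (contramod_isIso_iff A C _).2 (cofreeHom_bijective A C B D N X)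

/-- `N` is `[C, -]`-Galois if and only if the unit of the adjunction is an isomorphism at free
contramodules. -/
theorem isContraGalois_iff : IsContraGalois A C B D N ↔
    ∀ X, IsIso ((contraAdj A C B D N).unit.app ((contraMonad A C).free.obj X)) := by
  refine forall_congr' fun X => ?_
  -- The underlying map of this composite is `can` definitionally, and its second factor is
  -- invertible.
  let g : (contraMonad A C).free.obj X ⟶ homDContra A C B D N (tensorComod A C B D N X) :=
    (contraAdj A C B D N).unit.app ((contraMonad A C).free.obj X) ≫
      (homDFunctor A C B D N).map (freeTensorHom A C B D N X)
  have hi : IsIso ((homDFunctor A C B D N).map (freeTensorHom A C B D N X)) :=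
    Functor.map_isIso (homDFunctor A C B D N) (freeTensorHom A C B D N X)
  exact (contramod_isIso_iff A C g).symm.trans (@isIso_comp_right_iff _ _ _ _ _ _ _ hi)

/-- `N` is `D`-Galois if and only if the counit of the adjunction is an isomorphism at cofree
comodules. -/
theorem isComodGalois_iff : IsComodGalois A C B D N ↔
    ∀ X, IsIso ((contraAdj A C B D N).counit.app ((tensorComonad B D).cofree.obj X)) := by
  refine forall_congr' fun X => ?_
  -- The composite of an isomorphism with the counit; on pure tensors its underlying map agrees with
  -- `comodCan`.
  let g : contraTensorComod A C B D N (homContra A C B D N X) ⟶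
      (tensorComonad B D).cofree.obj X :=
    (contraTensorComodFunctor A C B D N).map (cofreeHom A C B D N X) ≫
      (contraAdj A C B D N).counit.app ((tensorComonad B D).cofree.obj X)
  have h : comodCan A C B D N X = g.f.hom := contraTensor_hom_ext A C B D N fun _ _ => rfl
  have hi : IsIso ((contraTensorComodFunctor A C B D N).map (cofreeHom A C B D N X)) :=
    Functor.map_isIso (contraTensorComodFunctor A C B D N) (cofreeHom A C B D N X)
  rw [h]
  exact (comod_isIso_iff B D g).symm.trans (@isIso_comp_left_iff _ _ _ _ _ _ _ hi)

end Bicomodule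

/-! ## Exactness of the monad and of the comonad -/

/-- Both functors carry the limit cone to a limit cone, and `α` at the cone point is the isomorphism
of limits induced by the isomorphism of diagrams. -/
theorem isIso_app_conePt_of_preservesLimit {𝒞 𝒟 J : Type*} [Category* 𝒞] [Category* 𝒟]
    [Category* J] (K : J ⥤ 𝒞) {F F' : 𝒞 ⥤ 𝒟} (α : F ⟶ F') (hα : ∀ j, IsIso (α.app (K.obj j)))
    (c : Cone K) (hc : IsLimit c) [PreservesLimit K F] [PreservesLimit K F'] :
    IsIso (α.app c.pt) := by
  have : ∀ j, IsIso ((Functor.whiskerLeft K α).app j) := hα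
  have : IsIso (Functor.whiskerLeft K α) := NatIso.isIso_of_isIso_app _
  let e := IsLimit.conePointsIsoOfNatIso
    (isLimitOfPreserves F hc) (isLimitOfPreserves F' hc) (asIso (Functor.whiskerLeft K α))
  have he : e.hom = α.app c.pt := by
    refine (isLimitOfPreserves F' hc).hom_ext fun j => ?_
    refine (IsLimit.conePointsIsoOfNatIso_hom_comp _ _ _ j).trans ?_
    exact (α.naturality (c.π.app j))
  rw [← he]
  infer_instance

/-- Middle exactness of - ⊗_R P on a right exact sequence. A left inverse of the map from the
cokernel of f ⊗ P to Z ⊗ P is built by lifting elements of `Z` along `g`. -/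
theorem TensorOver.exact_map {R : Type*} [Ring R] {X Y Z P : Type*} [AddCommGroup X]
    [Module Rᵐᵒᵖ X] [AddCommGroup Y] [Module Rᵐᵒᵖ Y] [AddCommGroup Z] [Module Rᵐᵒᵖ Z]
    [AddCommGroup P] [Module R P] (f : X →ₗ[Rᵐᵒᵖ] Y) (g : Y →ₗ[Rᵐᵒᵖ] Z)
    (hg : Function.Surjective g) (hfg : ∀ y, g y = 0 → ∃ x, f x = y) (t : TensorOver R Y P)
    (ht : TensorOver.map g (LinearMap.id : P →ₗ[R] P) t = 0) :
    ∃ s, TensorOver.map f (LinearMap.id : P →ₗ[R] P) s = t := by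
  let I : AddSubgroup (TensorOver R Y P) := (map f (LinearMap.id : P →ₗ[R] P)).range
  have key (y y' : Y) (h : g y = g y') (p : P) :
      QuotientAddGroup.mk' I (tmul R y p) = QuotientAddGroup.mk' I (tmul R y' p) := by
    obtain ⟨x, hx⟩ := hfg (y - y') (by rw [map_sub, h, sub_self])
    rw [← sub_eq_zero, ← map_sub]
    refine (QuotientAddGroup.eq_zero_iff _).2 ⟨tmul R x p, ?_⟩
    rw [map_tmul, hx, eq_sub_iff_add_eq, LinearMap.id_apply, ← add_tmul, sub_add_cancel]
  -- This section is only set-theoretic. By `key` the choice of lift is invisible modulo `I`, so z ⊗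
  -- p ↦ σ(z) ⊗ p becomes additive and balanced there.
  let σ : Z → Y := Function.surjInv hg
  have hσ (z : Z) : g (σ z) = z := Function.surjInv_eq hg z
  let ψ : TensorOver R Z P →+ TensorOver R Y P ⧸ I :=
    lift
      (AddMonoidHom.mk' (fun z => AddMonoidHom.mk' (fun p => QuotientAddGroup.mk' I (tmul R (σ z) p))
          (fun p p' => by rw [tmul_add, map_add]))
        (fun z z' => AddMonoidHom.ext fun p =>
          (key (σ (z + z')) (σ z + σ z') (by rw [map_add, hσ, hσ, hσ]) p).trans
            (by rw [add_tmul, map_add]; rfl)))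
      (fun z r p => (key (σ (op r • z)) (op r • σ z) (by rw [map_smul, hσ, hσ]) p).trans
        (by rw [smul_tmul]; rfl))
  have hψ : ψ.comp (map g (LinearMap.id : P →ₗ[R] P)) = QuotientAddGroup.mk' I :=
    hom_ext fun y p => key (σ (g y)) y (hσ _) p
  have h := DFunLike.congr_fun hψ t
  rw [AddMonoidHom.comp_apply, ht, map_zero] at h
  exact (QuotientAddGroup.eq_zero_iff _).1 h.symm

section Monad

variable (A C : Type u) [Ring A] [AddCommGroup C] [Module A C] [Module Aᵐᵒᵖ C]
    [SMulCommClass A Aᵐᵒᵖ C] [Coring A C]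

instance : (contraMonad A C).toFunctor.Additive where
  map_add := rfl

/-- It suffices to test short exact sequences. Maps out of the projective module `C` lift along
`S.g`, and those killed by `S.g` land in the range of `S.f` and lift along its range restriction. -/
theorem contraMonad_preservesFiniteColimits [Module.Projective Aᵐᵒᵖ C] :
    PreservesFiniteColimits (contraMonad A C).toFunctor := by
  refine ((contraMonad A C).toFunctor.preservesFiniteColimits_tfae.out 0 3).1 fun S hS => ?_
  constructor
  · rw [ShortComplex.moduleCat_exact_iff]
    intro (x : RHom A C S.X₂) hx
    have hx' (c : C) : S.g.hom (x c) = 0 := congrArg (fun φ : RHom A C S.X₃ => φ c) hx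
    obtain ⟨y, hy⟩ := Module.projective_lifting_property S.f.hom.rangeRestrict
      (LinearMap.codRestrict _ x.lin fun c =>
        (ShortComplex.moduleCat_exact_iff S).1 hS.exact (x c) (hx' c))
      S.f.hom.surjective_rangeRestrict
    exact ⟨RHom.ofLin y, RHom.ext fun c => congrArg Subtype.val (DFunLike.congr_fun hy c)⟩
  · rw [ModuleCat.epi_iff_surjective]
    intro (x : RHom A C S.X₃)
    obtain ⟨y, hy⟩ := Module.projective_lifting_property S.g.hom x.lin hS.moduleCat_surjective_g
    exact ⟨RHom.ofLin y, hy⟩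

theorem contramod_forget_preservesFiniteColimits [Module.Projective Aᵐᵒᵖ C] :
    PreservesFiniteColimits (contraMonad A C).forget where
  preservesFiniteColimits J _ _ := by
    have := contraMonad_preservesFiniteColimits A C
    infer_instance

/-- The forgetful functor preserves monos as a right adjoint and epis by exactness, modules are
balanced, and the functor reflects isomorphisms. -/
theorem contramod_balanced [Module.Projective Aᵐᵒᵖ C] : Balanced (Contramod A C) where
  isIso_of_mono_of_epi {M M'} f _ _ := by
    have := contramod_forget_preservesFiniteColimits A C
    have : IsIso ((contraMonad A C).forget.map f) := isIso_of_mono_of_epi _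
    exact isIso_of_reflects_iso f (contraMonad A C).forget

theorem contramod_surjective_of_epi [Module.Projective Aᵐᵒᵖ C] {M M' : Contramod A C}
    (f : M ⟶ M') [Epi f] : Function.Surjective f.f.hom := by
  have := contramod_forget_preservesFiniteColimits A C
  exact (ModuleCat.epi_iff_surjective ((contraMonad A C).forget.map f)).1 inferInstance

end Monad

section Comonad

variable (B D : Type u) [Ring B] [AddCommGroup D] [Module B D] [Module Bᵐᵒᵖ D]
    [SMulCommClass B Bᵐᵒᵖ D] [Coring B D]

instance : (tensorComonad B D).toFunctor.Additive where
  map_add {X Y f g} := by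
    refine ModuleCat.hom_ext (LinearMap.ext fun t => ?_)
    change TensorOver.rmap B D (f.hom + g.hom) t =
      TensorOver.rmap B D f.hom t + TensorOver.rmap B D g.hom t
    induction t using TensorOver.induction_on with
    | h0 => simp only [map_zero, add_zero]
    | ht m d => exact TensorOver.add_tmul _ _ d
    | ha x y hx hy => rw [map_add, map_add, map_add, hx, hy]; abel

variable {B D}

/-- Flatness is needed only for injectivity; exactness in the middle is automatic for a tensor
functor. -/
theorem tensorComonad_preservesFiniteLimits (hD : LeftFlat B D) :
    PreservesFiniteLimits (tensorComonad B D).toFunctor := by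
  refine ((tensorComonad B D).toFunctor.preservesFiniteLimits_tfae.out 0 3).1 fun S hS => ?_
  constructor
  · rw [ShortComplex.moduleCat_exact_iff]
    intro t ht
    exact TensorOver.exact_map S.f.hom S.g.hom hS.moduleCat_surjective_g
      ((ShortComplex.moduleCat_exact_iff S).1 hS.exact) t ht
  · rw [ModuleCat.mono_iff_injective]
    exact hD _ _ S.f.hom hS.moduleCat_injective_f

/-- The forgetful functor of a comonad creates those limits that the comonad preserves. -/
theorem comod_forget_preservesFiniteLimits (hD : LeftFlat B D) :
    PreservesFiniteLimits (tensorComonad B D).forget where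
  preservesFiniteLimits J _ _ := by
    have := tensorComonad_preservesFiniteLimits hD
    infer_instance

theorem comod_hasPullbacks (hD : LeftFlat B D) : HasPullbacks (Comod B D) := by
  have := tensorComonad_preservesFiniteLimits hD
  exact hasLimitsOfShape_of_hasLimitsOfShape_createsLimitsOfShape (tensorComonad B D).forget

instance : HasCoequalizers (Comod B D) :=
  hasColimitsOfShape_of_hasColimitsOfShape_createsColimitsOfShape (tensorComonad B D).forget

theorem comod_balanced (hD : LeftFlat B D) : Balanced (Comod B D) where
  isIso_of_mono_of_epi {Q P} f _ _ := by
    have := comod_forget_preservesFiniteLimits hD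
    have : IsIso ((tensorComonad B D).forget.map f) := isIso_of_mono_of_epi _
    exact isIso_of_reflects_iso f (tensorComonad B D).forget

end Comonad

/-! ## Transformations of functors on algebras and coalgebras -/

/-- Beck's presentation exhibits `M` as a coequalizer of two maps between free algebras, where `α`
is invertible by assumption. -/
theorem CategoryTheory.Monad.isIso_app_of_free {𝒞 𝒟 : Type*} [Category* 𝒞] [Category* 𝒟]
    {T : Monad 𝒞} {F F' : T.Algebra ⥤ 𝒟} (α : F ⟶ F')
    [PreservesColimitsOfShape WalkingParallelPair F]
    [PreservesColimitsOfShape WalkingParallelPair F']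
    (hα : ∀ X, IsIso (α.app (T.free.obj X))) (M : T.Algebra) : IsIso (α.app M) := by
  let K := parallelPair (Monad.FreeCoequalizer.topMap M) (Monad.FreeCoequalizer.bottomMap M)
  have : ∀ j, IsIso ((Functor.whiskerLeft K α).app j) := by
    rintro (_ | _)
    · exact hα _
    · exact hα _
  have : IsIso (Functor.whiskerLeft K α) := NatIso.isIso_of_isIso_app _
  exact isIso_app_coconePt_of_preservesColimit K α _ (Monad.beckAlgebraCoequalizer M)

/-- Dually, `Q` is the equalizer of its Beck pair of maps between cofree coalgebras. -/
theorem CategoryTheory.Comonad.isIso_app_of_cofree {𝒞 𝒟 : Type*} [Category* 𝒞] [Category* 𝒟]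
    {T : Comonad 𝒞} {F F' : T.Coalgebra ⥤ 𝒟} (α : F ⟶ F')
    [PreservesLimitsOfShape WalkingParallelPair F]
    [PreservesLimitsOfShape WalkingParallelPair F']
    (hα : ∀ X, IsIso (α.app (T.cofree.obj X))) (Q : T.Coalgebra) : IsIso (α.app Q) := by
  let K := parallelPair (Comonad.CofreeEqualizer.topMap Q) (Comonad.CofreeEqualizer.bottomMap Q)
  refine isIso_app_conePt_of_preservesLimit K α ?_ _ (Comonad.beckCoalgebraEqualizer Q)
  rintro (_ | _)
  · exact hα _
  · exact hα _

/-! ## Coequalizers and pullbacks of modules -/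

/-- The quotient of `Y` by the range of f - g is a competing cofork, so its projection factors
through `π` and kills the kernel of `π`. -/
theorem ModuleCat.exists_sub_of_isColimit_cofork {R : Type*} [Ring R] {X Y Z : ModuleCat.{u} R}
    {f g : X ⟶ Y} {π : Y ⟶ Z} (w : f ≫ π = g ≫ π) (h : IsColimit (Cofork.ofπ π w)) (y : Y)
    (hy : π.hom y = 0) : ∃ x, (f.hom - g.hom) x = y := by
  let q : Y ⟶ ModuleCat.of R (Y ⧸ LinearMap.range (f.hom - g.hom)) :=
    ModuleCat.ofHom (Submodule.mkQ _)
  have hq : f ≫ q = g ≫ q := by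
    refine ModuleCat.hom_ext (LinearMap.ext fun x => ?_)
    exact (Submodule.Quotient.eq _).2 ⟨x, rfl⟩
  have hd : π ≫ h.desc (Cofork.ofπ q hq) = q := h.fac (Cofork.ofπ q hq) WalkingParallelPair.one
  have hy' : q.hom y = 0 := by
    rw [← hd]
    exact (congrArg (h.desc (Cofork.ofπ q hq)).hom hy).trans (map_zero _)
  exact (Submodule.Quotient.mk_eq_zero _).1 hy'

/-- A surjective cofork of modules whose kernel consists of differences is a coequalizer. -/
def ModuleCat.isColimitCofork {R : Type*} [Ring R] {X Y Z : ModuleCat.{u} R}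
    {f g : X ⟶ Y} {π : Y ⟶ Z} (w : f ≫ π = g ≫ π) (hπ : Function.Surjective π.hom)
    (h : ∀ y, π.hom y = 0 → ∃ x, (f.hom - g.hom) x = y) : IsColimit (Cofork.ofπ π w) :=
  have : Epi π := (ModuleCat.epi_iff_surjective π).2 hπ
  have hs (s : Cofork f g) : LinearMap.ker π.hom ≤ LinearMap.ker s.π.hom := fun y hy => by
    obtain ⟨x, rfl⟩ := h y hy
    have hx : s.π.hom (f.hom x) = s.π.hom (g.hom x) := congrArg (fun φ => φ.hom x) s.condition
    rw [LinearMap.mem_ker, LinearMap.sub_apply, map_sub, hx, sub_self]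
  have fac (s : Cofork f g) : π ≫ ModuleCat.ofHom ((Submodule.liftQ _ s.π.hom (hs s)).comp
      (π.hom.quotKerEquivOfSurjective hπ).symm.toLinearMap) = s.π := by
    refine ModuleCat.hom_ext (LinearMap.ext fun y => ?_)
    change Submodule.liftQ _ s.π.hom (hs s) ((π.hom.quotKerEquivOfSurjective hπ).symm (π.hom y)) = _
    have hy : (π.hom.quotKerEquivOfSurjective hπ).symm (π.hom y) = Submodule.Quotient.mk y :=
      (LinearEquiv.symm_apply_eq _).2 rfl
    rw [hy]
    rfl
  Cofork.IsColimit.mk _ _ fac fun s m hm => by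
    rw [← cancel_epi π]
    exact hm.trans (fac s).symm

/-- Elements of a module are maps out of `R`, so a compatible pair of elements lifts to the
pullback. -/
theorem ModuleCat.exists_of_isPullback {R : Type u} [Ring R] {P X Y Z : ModuleCat.{u} R}
    {fst : P ⟶ X} {snd : P ⟶ Y} {f : X ⟶ Z} {g : Y ⟶ Z} (h : IsPullback fst snd f g)
    (x : X) (y : Y) (hxy : f.hom x = g.hom y) : ∃ p, snd.hom p = y := by
  let a : ModuleCat.of R R ⟶ X := ModuleCat.ofHom (LinearMap.toSpanSingleton R X x)
  let b : ModuleCat.of R R ⟶ Y := ModuleCat.ofHom (LinearMap.toSpanSingleton R Y y)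
  have w : a ≫ f = b ≫ g := by
    refine ModuleCat.hom_ext (LinearMap.ext fun r => ?_)
    change f.hom (r • x) = g.hom (r • y)
    rw [map_smul, map_smul, hxy]
  refine ⟨(h.lift a b w).hom (1 : R), ?_⟩
  exact (congrArg (fun φ => φ.hom (1 : R)) (h.lift_snd a b w)).trans (one_smul R y)

namespace Bicomodule

variable (A C B D N : Type u) [Ring A] [AddCommGroup C] [Module A C] [Module Aᵐᵒᵖ C]
    [SMulCommClass A Aᵐᵒᵖ C] [Coring A C] [Ring B] [AddCommGroup D] [Module B D] [Module Bᵐᵒᵖ D]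
    [SMulCommClass B Bᵐᵒᵖ D] [Coring B D] [AddCommGroup N] [Module A N] [Module Bᵐᵒᵖ N]
    [SMulCommClass A Bᵐᵒᵖ N] [Bicomodule A C B D N]

/-! ## The functor of comodule maps -/

/-- Morphisms of comodules out of `N` are the elements of `Hom^D(N, Q)`. -/
def homDEquiv (Q : Comod B D) : (toComod A C B D N ⟶ Q) ≃ homD A C B D N Q where
  toFun h := ⟨RHom.ofLin h.f.hom, fun n => (congrArg (fun φ => φ.hom n) h.h).symm⟩
  invFun f :=
    { f := ModuleCat.ofHom f.1.lin
      h := ModuleCat.hom_ext (LinearMap.ext fun n => (f.2 n).symm) }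
  left_inv _ := rfl
  right_inv _ := rfl

theorem homDMap_homDEquiv {Q P : Comod B D} (g : Q ⟶ P) (h : toComod A C B D N ⟶ Q) :
    homDMap A C B D N g (homDEquiv A C B D N Q h) = homDEquiv A C B D N P (h ≫ g) := rfl

/-- Elements of Hom^D(N, Q) are the morphisms N ⟶ Q, so faithfulness says that such morphisms detect
equality. -/
theorem faithful_iff_isSeparator :
    (homDFunctor A C B D N).Faithful ↔ IsSeparator (toComod A C B D N) := by
  rw [isSeparator_def]
  constructor
  · intro hF Q P f g h
    refine (homDFunctor A C B D N).map_injective (Monad.Algebra.Hom.ext (ModuleCat.hom_ext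
      (LinearMap.ext fun x => ?_)))
    obtain ⟨x, rfl⟩ := (homDEquiv A C B D N Q).surjective x
    change homDMap A C B D N f _ = homDMap A C B D N g _
    rw [homDMap_homDEquiv, homDMap_homDEquiv, h]
  · intro h
    refine ⟨fun {Q P f g} hfg => h f g fun x => (homDEquiv A C B D N P).injective ?_⟩
    rw [← homDMap_homDEquiv, ← homDMap_homDEquiv]
    exact congrArg (fun φ => φ.f.hom (homDEquiv A C B D N Q x)) hfg

theorem homDMap_surjective [Projective (toComod A C B D N)] {Q P : Comod B D} (g : Q ⟶ P)
    [Epi g] : Function.Surjective (homDMap A C B D N g) := by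
  intro x
  obtain ⟨x, rfl⟩ := (homDEquiv A C B D N P).surjective x
  exact ⟨homDEquiv A C B D N Q (Projective.factorThru x g), by
    rw [homDMap_homDEquiv, Projective.factorThru_comp]⟩

theorem projective_of_homDMap_surjective
    (h : ∀ {Q P : Comod B D} (g : Q ⟶ P) [Epi g], Function.Surjective (homDMap A C B D N g)) :
    Projective (toComod A C B D N) where
  factors {P Q} f g _ := by
    obtain ⟨x, hx⟩ := h g (homDEquiv A C B D N _ f)
    obtain ⟨x, rfl⟩ := (homDEquiv A C B D N P).surjective x
    rw [homDMap_homDEquiv] at hx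
    exact ⟨x, (homDEquiv A C B D N _).injective hx⟩

/-- The difference of two comodule maps. -/
def comodSub {Q P : Comod B D} (f g : Q ⟶ P) : Q ⟶ P where
  f := f.f - g.f
  h := by
    rw [(tensorComonad B D).toFunctor.map_sub, Preadditive.comp_sub, Preadditive.sub_comp, f.h, g.h]

/-- For `D` flat and `N` projective, a comodule map from `N` into the image of a comodule map
lifts. -/
theorem exists_homDMap_eq (hD : LeftFlat B D) [Projective (toComod A C B D N)] {P Q : Comod B D}
    (g : P ⟶ Q) (x : homD A C B D N Q) (hx : ∀ n, ∃ p, g.f.hom p = x.1 n) :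
    ∃ y, homDMap A C B D N g y = x := by
  obtain ⟨x, rfl⟩ := (homDEquiv A C B D N Q).surjective x
  have := comod_hasPullbacks hD
  have := comod_forget_preservesFiniteLimits hD
  -- By flatness the pullback of `g` along `x` is computed on modules. Its projection to `N` is then
  -- surjective, hence epi, hence split by projectivity; the splitting followed by the other
  -- projection is the lift.
  have hp := (IsPullback.of_hasPullback g x).map (tensorComonad B D).forget
  have : Epi ((tensorComonad B D).forget.map (pullback.snd g x)) := by
    rw [ModuleCat.epi_iff_surjective]
    intro n
    obtain ⟨p, hp'⟩ := hx n
    exact ModuleCat.exists_of_isPullback hp p n hp'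
  have : Epi (pullback.snd g x) := (tensorComonad B D).forget.epi_of_epi_map this
  refine ⟨homDEquiv A C B D N P
    (Projective.factorThru (𝟙 _) (pullback.snd g x) ≫ pullback.fst g x), ?_⟩
  rw [homDMap_homDEquiv, Category.assoc, pullback.condition, Projective.factorThru_comp_assoc,
    Category.id_comp]

/-- Projectivity makes Hom^D(N, -) carry the coequalizer map to a surjection. It remains to show
that a comodule map from `N` killed by the coequalizer of `φ` and `ψ` lifts along φ - ψ. -/
theorem homD_preservesCoequalizers (hD : LeftFlat B D) [Projective (toComod A C B D N)] :
    PreservesColimitsOfShape WalkingParallelPair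
      (homDFunctor A C B D N ⋙ (contraMonad A C).forget) where
  preservesColimit {K} := by
    let φ := K.map WalkingParallelPairHom.left
    let ψ := K.map WalkingParallelPairHom.right
    suffices PreservesColimit (parallelPair φ ψ)
        (homDFunctor A C B D N ⋙ (contraMonad A C).forget) from
      preservesColimit_of_iso_diagram _ (diagramIsoParallelPair K).symm
    refine preservesColimit_of_preserves_colimit_cocone (coequalizerIsCoequalizer φ ψ) ?_
    refine (isColimitMapCoconeCoforkEquiv _ (coequalizer.condition φ ψ)).2 ?_
    refine ModuleCat.isColimitCofork _ (homDMap_surjective A C B D N (coequalizer.π φ ψ)) ?_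
    intro (x : homD A C B D N _) hx
    have hx' (n : N) : (coequalizer.π φ ψ).f.hom (x.1 n) = 0 :=
      congrArg (fun y : homD A C B D N (coequalizer φ ψ) => y.1 n) hx
    -- The coequalizer of comodules is also one of modules, so each value of `x` lies in the image
    -- of φ - ψ.
    obtain ⟨y, hy⟩ := exists_homDMap_eq A C B D N hD (comodSub B D φ ψ) x fun n =>
      ModuleCat.exists_sub_of_isColimit_cofork _
        ((isColimitMapCoconeCoforkEquiv (tensorComonad B D).forget
          (coequalizer.condition φ ψ)) (isColimitOfPreserves _ (coequalizerIsCoequalizer φ ψ)))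
        (x.1 n) (hx' n)
    exact ⟨y, hy⟩

/-- The map of comodules `f ⊗_A N`. -/
def tensorComodMap {X Y : ModuleCat.{u} Aᵐᵒᵖ} (f : X ⟶ Y) :
    tensorComod A C B D N X ⟶ tensorComod A C B D N Y where
  f := ModuleCat.ofHom (TensorOver.rmap B N f.hom)
  h := ModuleCat.hom_ext (LinearMap.ext fun t =>
    (coactOn_naturality f.hom (rhoR A C B D N) t).symm)

theorem rmap_surjective {X Y : Type*} [AddCommGroup X] [Module Aᵐᵒᵖ X]
    [AddCommGroup Y] [Module Aᵐᵒᵖ Y] (f : X →ₗ[Aᵐᵒᵖ] Y) (hf : Function.Surjective f) :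
    Function.Surjective (TensorOver.rmap B N f) := by
  intro t
  induction t using TensorOver.induction_on with
  | h0 => exact ⟨0, map_zero _⟩
  | ht y n =>
    obtain ⟨x, rfl⟩ := hf y
    exact ⟨TensorOver.tmul A x n, rfl⟩
  | ha s t hs ht =>
    obtain ⟨s, rfl⟩ := hs
    obtain ⟨t, rfl⟩ := ht
    exact ⟨s + t, map_add _ _ _⟩

theorem can_naturality {X Y : ModuleCat.{u} Aᵐᵒᵖ} (f : X ⟶ Y) (g : RHom A C X) :
    can A C B D N Y (RHom.postcomp (A := A) f.hom g) =
      homDMap A C B D N (tensorComodMap A C B D N f) (can A C B D N X g) :=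
  Subtype.ext (RHom.ext fun n => rmap_comp A B N g.lin f.hom (rhoL A C B D N n))

/-- For a surjection f : F → C with `F` free, f ⊗_A N is an epimorphism of comodules, so can(id_C)
lifts along it. By the Galois property the lift is can(g), and naturality with injectivity of `can`
gives f ∘ g = id. -/
theorem projective_of_isContraGalois (hN : IsContraGalois A C B D N)
    [Projective (toComod A C B D N)] : Module.Projective Aᵐᵒᵖ C := by
  refine Module.Projective.of_lifting_property'' fun f hf => ?_
  let f' : ModuleCat.of Aᵐᵒᵖ (C →₀ Aᵐᵒᵖ) ⟶ ModuleCat.of Aᵐᵒᵖ C := ModuleCat.ofHom f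
  have : Epi ((tensorComonad B D).forget.map (tensorComodMap A C B D N f')) :=
    (ModuleCat.epi_iff_surjective _).2 (rmap_surjective A B N f hf)
  have : Epi (tensorComodMap A C B D N f') := (tensorComonad B D).forget.epi_of_epi_map this
  obtain ⟨y, hy⟩ := homDMap_surjective A C B D N (tensorComodMap A C B D N f')
    (can A C B D N (ModuleCat.of Aᵐᵒᵖ C) (RHom.ofLin LinearMap.id))
  obtain ⟨g, rfl⟩ := (hN _).2 y
  rw [← can_naturality] at hy
  exact ⟨g.lin, (hN _).1 hy⟩

/-! ## The equivalences -/

theorem isEquivalence_of_isIso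
    (hη : ∀ M, IsIso ((contraAdj A C B D N).unit.app M))
    (hε : ∀ Q, IsIso ((contraAdj A C B D N).counit.app Q)) :
    (homDFunctor A C B D N).IsEquivalence :=
  (contraAdj A C B D N).toEquivalence.isEquivalence_inverse

theorem isEquivalence_of_isContraGalois (hD : LeftFlat B D) (hN : IsContraGalois A C B D N)
    [Projective (toComod A C B D N)] (hs : IsSeparator (toComod A C B D N)) :
    (homDFunctor A C B D N).IsEquivalence := by
  have := projective_of_isContraGalois A C B D N hN
  have := homD_preservesCoequalizers A C B D N hD
  have := contramod_forget_preservesFiniteColimits A C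
  have := comod_balanced hD
  have := (faithful_iff_isSeparator A C B D N).2 hs
  have hG := (isContraGalois_iff A C B D N).1 hN
  have : (contraTensorComodFunctor A C B D N).IsLeftAdjoint :=
    (contraAdj A C B D N).isLeftAdjoint
  have hη (M : Contramod A C) : IsIso ((contraAdj A C B D N).unit.app M) := by
    -- The unit is compared after forgetting to modules, where source and target both preserve
    -- coequalizers.
    let α : (contraMonad A C).forget ⟶ contraTensorComodFunctor A C B D N ⋙
        (homDFunctor A C B D N ⋙ (contraMonad A C).forget) :=
      Functor.whiskerRight (contraAdj A C B D N).unit (contraMonad A C).forget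
    have hM : IsIso (α.app M) := Monad.isIso_app_of_free α (fun X =>
      have := hG X
      Functor.map_isIso (contraMonad A C).forget _) M
    have : IsIso ((contraMonad A C).forget.map ((contraAdj A C B D N).unit.app M)) := hM
    exact isIso_of_reflects_iso _ (contraMonad A C).forget
  refine isEquivalence_of_isIso A C B D N hη fun Q => ?_
  -- The triangle identity makes this map a one-sided inverse of an invertible unit. The functor is
  -- faithful on a balanced category, so it reflects isomorphisms.
  have : IsIso ((homDFunctor A C B D N).map ((contraAdj A C B D N).counit.app Q)) := by
    have := hη ((homDFunctor A C B D N).obj Q)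
    exact isIso_of_hom_comp_eq_id _ ((contraAdj A C B D N).right_triangle_components Q)
  exact isIso_of_reflects_iso _ (homDFunctor A C B D N)

/-- For `f` injective, Hom_B(N, f) is a monomorphism of contramodules, which the left exact
contratensor functor keeps injective. Through the isomorphisms `comodCan` the result is f ⊗_B D. -/
theorem leftFlat_of_isComodGalois (hN : IsComodGalois A C B D N)
    [PreservesFiniteLimits (contraTensorFunctor A C B D N)] : LeftFlat B D := by
  intro X Y _ _ _ _ f hf
  let f' : ModuleCat.of Bᵐᵒᵖ X ⟶ ModuleCat.of Bᵐᵒᵖ Y := ModuleCat.ofHom f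
  let g : homContra A C B D N (ModuleCat.of Bᵐᵒᵖ X) ⟶
      homContra A C B D N (ModuleCat.of Bᵐᵒᵖ Y) :=
    { f := ModuleCat.ofHom (RHom.postcomp f)
      h := ModuleCat.hom_ext (LinearMap.ext fun h =>
        RHom.contract_postcomp f (rhoL A C B D N) h) }
  have : Mono g.f := by
    rw [ModuleCat.mono_iff_injective]
    exact fun x y hxy => RHom.ext fun n => hf (congrArg (fun z : RHom B N Y => z n) hxy)
  have : Mono g := Monad.algebra_mono_of_mono (contraMonad A C) g
  have hg : Function.Injective (contraTensorMap A C B D N g) :=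
    (ModuleCat.mono_iff_injective ((contraTensorFunctor A C B D N).map g)).1 inferInstance
  have h : (TensorOver.rmap B D f).comp (comodCan A C B D N (ModuleCat.of Bᵐᵒᵖ X)) =
      (comodCan A C B D N (ModuleCat.of Bᵐᵒᵖ Y)).comp (contraTensorMap A C B D N g) :=
    contraTensor_hom_ext A C B D N fun x n =>
      (rmap_comp B B D (RHom.lin x) f (rhoR A C B D N n)).symm
  intro s t hst
  obtain ⟨s, rfl⟩ := (hN (ModuleCat.of Bᵐᵒᵖ X)).2 s
  obtain ⟨t, rfl⟩ := (hN (ModuleCat.of Bᵐᵒᵖ X)).2 t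
  refine congrArg _ (hg ((hN (ModuleCat.of Bᵐᵒᵖ Y)).1 ?_))
  exact (DFunLike.congr_fun h s).symm.trans (Eq.trans hst (DFunLike.congr_fun h t))

theorem isEquivalence_of_isComodGalois [Module.Projective Aᵐᵒᵖ C]
    (hN : IsComodGalois A C B D N) [PreservesFiniteLimits (contraTensorFunctor A C B D N)]
    [(contraTensorFunctor A C B D N).Faithful] :
    (homDFunctor A C B D N).IsEquivalence := by
  have hD := leftFlat_of_isComodGalois A C B D N hN
  have := comod_forget_preservesFiniteLimits hD
  have := contramod_balanced A C
  have hG := (isComodGalois_iff A C B D N).1 hN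
  have : (homDFunctor A C B D N).IsRightAdjoint := (contraAdj A C B D N).isRightAdjoint
  -- A faithful functor reflects monos and epis, which suffices because contramodules are balanced
  -- when `C` is projective.
  have : (contraTensorFunctor A C B D N).ReflectsIsomorphisms :=
    reflectsIsomorphisms_of_reflectsMonomorphisms_of_reflectsEpimorphisms _
  have hε (Q : Comod B D) : IsIso ((contraAdj A C B D N).counit.app Q) := by
    -- Both functors preserve equalizers: the first is a right adjoint followed by a left exact
    -- functor, the second is left exact by flatness of `D`.
    let α : homDFunctor A C B D N ⋙ contraTensorFunctor A C B D N ⟶ (tensorComonad B D).forget :=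
      Functor.whiskerRight (contraAdj A C B D N).counit (tensorComonad B D).forget
    have hQ : IsIso (α.app Q) := Comonad.isIso_app_of_cofree α (fun X =>
      have := hG X
      Functor.map_isIso (tensorComonad B D).forget _) Q
    have : IsIso ((tensorComonad B D).forget.map ((contraAdj A C B D N).counit.app Q)) := hQ
    exact isIso_of_reflects_iso _ (tensorComonad B D).forget
  refine isEquivalence_of_isIso A C B D N (fun M => ?_) hε
  -- The other triangle identity: the counit at the image of `M` is invertible, hence so is this
  -- map.
  have : IsIso ((contraTensorComodFunctor A C B D N).map ((contraAdj A C B D N).unit.app M)) := by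
    have := hε ((contraTensorComodFunctor A C B D N).obj M)
    exact isIso_of_comp_hom_eq_id _ ((contraAdj A C B D N).left_triangle_components M)
  have : IsIso ((contraTensorFunctor A C B D N).map ((contraAdj A C B D N).unit.app M)) :=
    Functor.map_isIso (tensorComonad B D).forget
      ((contraTensorComodFunctor A C B D N).map ((contraAdj A C B D N).unit.app M))
  exact isIso_of_reflects_iso _ (contraTensorFunctor A C B D N)

end Bicomodule

end

/-! ### The equivalence of the three conditions -/

theorem mainTheorem5 (A C B D N : Type u) [Ring A] [Ring B]
    [AddCommGroup C] [Module A C] [Module Aᵐᵒᵖ C] [SMulCommClass A Aᵐᵒᵖ C] [Coring A C]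
    [AddCommGroup D] [Module B D] [Module Bᵐᵒᵖ D] [SMulCommClass B Bᵐᵒᵖ D] [Coring B D]
    [AddCommGroup N] [Module A N] [Module Bᵐᵒᵖ N] [SMulCommClass A Bᵐᵒᵖ N]
    [Bicomodule A C B D N] :
    List.TFAE [
      (Bicomodule.homDFunctor A C B D N).IsEquivalence ∧
        Module.Projective Aᵐᵒᵖ C ∧ LeftFlat B D,
      LeftFlat B D ∧ Bicomodule.IsContraGalois A C B D N ∧
        Projective (Bicomodule.toComod A C B D N) ∧ IsSeparator (Bicomodule.toComod A C B D N),
      Module.Projective Aᵐᵒᵖ C ∧ Bicomodule.IsComodGalois A C B D N ∧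
        PreservesFiniteLimits (Bicomodule.contraTensorFunctor A C B D N) ∧
        (Bicomodule.contraTensorFunctor A C B D N).Faithful] := by
  tfae_have 1 → 2 := by
    rintro ⟨hG, hC, hD⟩
    -- The left adjoint of an equivalence is an equivalence, so the unit is invertible, in
    -- particular on free contramodules.
    have := (Bicomodule.contraAdj A C B D N).isEquivalence_left_of_isEquivalence_right
    refine ⟨hD, (Bicomodule.isContraGalois_iff A C B D N).2 fun X => inferInstance, ?_,
      (Bicomodule.faithful_iff_isSeparator A C B D N).1 inferInstance⟩
    refine Bicomodule.projective_of_homDMap_surjective A C B D N fun g _ => ?_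
    -- An equivalence preserves epimorphisms, and epimorphisms of contramodules are surjective since
    -- `C` is projective.
    exact contramod_surjective_of_epi A C ((Bicomodule.homDFunctor A C B D N).map g)
  tfae_have 1 → 3 := by
    rintro ⟨hG, hC, hD⟩
    have := (Bicomodule.contraAdj A C B D N).isEquivalence_left_of_isEquivalence_right
    have := comod_forget_preservesFiniteLimits hD
    refine ⟨hC, (Bicomodule.isComodGalois_iff A C B D N).2 fun X => inferInstance, ?_, ?_⟩
    -- An equivalence followed by the forgetful functor of comodules, which is left exact by
    -- flatness of `D` and always faithful.
    · rw [← Bicomodule.contraTensorComodFunctor_comp_forget]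
      exact comp_preservesFiniteLimits _ _
    · rw [← Bicomodule.contraTensorComodFunctor_comp_forget]
      infer_instance
  tfae_have 2 → 1 := fun ⟨hD, hN, _, hs⟩ =>
    ⟨Bicomodule.isEquivalence_of_isContraGalois A C B D N hD hN hs,
      Bicomodule.projective_of_isContraGalois A C B D N hN, hD⟩
  tfae_have 3 → 1 := fun ⟨hC, hN, _, _⟩ =>
    ⟨Bicomodule.isEquivalence_of_isComodGalois A C B D N hN, hC,
      Bicomodule.leftFlat_of_isComodGalois A C B D N hN⟩
  tfae_finish
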